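/- Fix an integer $d\ge 1$ and a real number $\rho>0$. For each $n\ge 1$ let $Z_1,\dots,Z_d$ be $d$ infinite sequences (pools) of independent random variables, all uniformly distributed on the set $[n]$ of $n$ bins. In the $d$-thinning process balls are allocated one by one. Each ball is first offered the next unused element of the pool $Z_1$ (its primary, or $1$-ary, allocation); whenever its $i$-ary allocation is rejected, $i<d$, it is offered the next unused element of the pool $Z_{i+1}$ (its $(i+1)$-ary allocation); a $d$-ary allocation cannot be rejected. The ball is placed into the first bin that is not rejected. A $d$-thinning strategy is a rule that decides for each offered $i$-ary allocation, $i<d$, whether it is rejected; the decision may depend on everything that has happened so far (including the current offer) and on external random data, as long as all of this is jointly independent of the future allocations, that is, of the unused parts of all pools. Let $\mathrm{MaxLoad}^f(t)$ be the largest number of balls in a bin after $t$ balls have been allocated by the strategy $f$. For real $\ell$, the $\ell$-threshold strategy accepts an $i$-ary allocation, $i<d$, if and only if at most $\ell$ of the previous balls were placed into the offered bin by accepting it as their $i$-ary allocation. Let $\ell_n=\left(\frac{d\log n}{\log\log n}\right)^{1/d}$ and let $f$ be the $\ell_n$-threshold strategy for the $d$-thinning of $\lfloor\rho n\rfloor$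 balls into $n$ bins. Then, as $n\to\infty$ with $d$ and $\rho$ fixed: (1) $f$ is asymptotically optimal: it is a $d$-thinning strategy, and for every $d$-thinning strategy $g$ (a sequence of strategies, one for each $n$, run on the same pools) there is a sequence $\varepsilon_n\to 0$ such that $$\mathbb{P}\left(\mathrm{MaxLoad}^f(\lfloor\rho n\rfloor)\le (1+\varepsilon_n)\,\mathrm{MaxLoad}^g(\lfloor\rho n\rfloor)\right)\to 1 .$$ (2) With high probability $\mathrm{MaxLoad}^f(\lfloor\rho n\rfloor)=(d+o(1))\,\ell_n$, that is, there is a sequence $\varepsilon_n\to 0$ such that $$\mathbb{P}\left(\left|\mathrm{MaxLoad}^f(\lfloor\rho n\rfloor)-d\,\ell_n\right|\le\varepsilon_n\,\ell_n\right)\to 1 .$$ -/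

import Mathlib

open MeasureTheory ProbabilityTheory Filter Topology

namespace Thinning

/-! ### The allocation process for one realization

Balls are numbered `t = 0, 1, 2, …` and rounds `i = 0, …, d - 1`, so that ball `t` is the
`(t + 1)`-st ball and round `i` is the `(i + 1)`-ary round. A realization consists of the pools
`z : Fin d → ℕ → Fin n` (the element `z i r` is the `r`-th element of the pool of round `i`) and of
the decisions `a : ℕ → Fin (d - 1) → Bool`, where `a t i = true` means that the overseer rejects
the allocation that is offered to ball `t` in round `i`. -/

/-- The decision on ball `t` in round `i`; the allocation of the last round cannot be rejected. -/
def rejects {d : ℕ} (a : ℕ → Fin (d - 1) → Bool) (t i : ℕ) : Bool :=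
  if h : i < d - 1 then a t ⟨i, h⟩ else false

/-- All allocations offered to ball `t` in the rounds before round `i` are rejected. -/
def reaches {d : ℕ} (a : ℕ → Fin (d - 1) → Bool) (t i : ℕ) : Prop :=
  ∀ j < i, rejects a t j = true

open Classical in
/-- How many of the first `t` balls reach round `i`; equivalently, how many elements of the pool of
round `i` have been used after `t` balls. -/
noncomputable def used {d : ℕ} (a : ℕ → Fin (d - 1) → Bool) (t i : ℕ) : ℕ :=
  ((Finset.range t).filter fun k => reaches a k i).card

/-- The bin offered to ball `t` in round `i` (if the ball reaches this round): the first unused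
element of the pool of round `i`. -/
noncomputable def offer {d n : ℕ} (a : ℕ → Fin (d - 1) → Bool) (z : Fin d → ℕ → Fin n)
    (t : ℕ) (i : Fin d) : Fin n :=
  z i (used a t i)

theorem exists_rejects_eq_false {d : ℕ} (a : ℕ → Fin (d - 1) → Bool) (t : ℕ) :
    ∃ i, rejects a t i = false :=
  ⟨d - 1, by simp [rejects]⟩

/-- The round whose allocation is accepted for ball `t`: the first one that is not rejected. -/
def chosen {d : ℕ} [NeZero d] (a : ℕ → Fin (d - 1) → Bool) (t : ℕ) : Fin d :=
  ⟨Nat.find (exists_rejects_eq_false a t),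
    lt_of_le_of_lt
      (Nat.find_min' (exists_rejects_eq_false a t) (m := d - 1) (by simp [rejects]))
      (Nat.sub_lt (NeZero.pos d) one_pos)⟩

/-- The bin into which ball `t` is finally placed. -/
noncomputable def finalBin {d n : ℕ} [NeZero d] (a : ℕ → Fin (d - 1) → Bool)
    (z : Fin d → ℕ → Fin n) (t : ℕ) : Fin n :=
  offer a z t (chosen a t)

/-- The load of bin `m` after `t` balls. -/
noncomputable def load {d n : ℕ} [NeZero d] (a : ℕ → Fin (d - 1) → Bool)
    (z : Fin d → ℕ → Fin n) (m : Fin n) (t : ℕ) : ℕ :=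
  ((Finset.range t).filter fun k => finalBin a z k = m).card

/-- The number of balls among the first `t` that accepted bin `m` in round `i`. -/
noncomputable def roundLoad {d n : ℕ} [NeZero d] (a : ℕ → Fin (d - 1) → Bool)
    (z : Fin d → ℕ → Fin n) (i : Fin d) (m : Fin n) (t : ℕ) : ℕ :=
  ((Finset.range t).filter fun k => chosen a k = i ∧ finalBin a z k = m).card

/-- The maximum load after `t` balls. -/
noncomputable def maxLoad {d n : ℕ} [NeZero d] (a : ℕ → Fin (d - 1) → Bool)
    (z : Fin d → ℕ → Fin n) (t : ℕ) : ℕ :=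
  Finset.univ.sup fun m : Fin n => load a z m t

/-! ### The threshold strategy -/

/-- A round `i < d - 1`, as one of the `d` rounds. -/
def toRound {d : ℕ} (i : Fin (d - 1)) : Fin d := Fin.castLE (Nat.sub_le d 1) i

/-- The decisions of the `ℓ`-threshold strategy on the first `t` balls (later entries are
placeholders), by recursion on `t`. -/
noncomputable def thresholdTable {d n : ℕ} [NeZero d] (ℓ : ℝ) (z : Fin d → ℕ → Fin n) :
    ℕ → ℕ → Fin (d - 1) → Bool
  | 0 => fun _ _ => false
  | t + 1 => Function.update (thresholdTable ℓ z t) t fun i =>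
      decide (ℓ < (roundLoad (thresholdTable ℓ z t) z (toRound i)
        (offer (thresholdTable ℓ z t) z t (toRound i)) t : ℝ))

/-- The decisions of the `ℓ`-threshold strategy: the allocation offered to ball `t` in round
`i < d - 1` is accepted if and only if at most `ℓ` of the previous balls accepted the offered bin in
round `i` (see `threshold_eq` below). -/
noncomputable def threshold {d n : ℕ} [NeZero d] (ℓ : ℝ) (z : Fin d → ℕ → Fin n) :
    ℕ → Fin (d - 1) → Bool :=
  fun t => thresholdTable ℓ z (t + 1) t

section Locality

variable {d n : ℕ} {a b : ℕ → Fin (d - 1) → Bool}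

theorem rejects_congr {t : ℕ} (h : a t = b t) (i : ℕ) : rejects a t i = rejects b t i := by
  simp [rejects, h]

theorem used_congr {t : ℕ} (h : ∀ k < t, a k = b k) (i : ℕ) : used a t i = used b t i := by
  classical
  unfold used
  congr 1
  refine Finset.filter_congr fun k hk => ?_
  have hk' := h k (Finset.mem_range.1 hk)
  simp only [reaches, rejects_congr hk']

theorem offer_congr (z : Fin d → ℕ → Fin n) {t : ℕ} (h : ∀ k < t, a k = b k) (i : Fin d) :
    offer a z t i = offer b z t i := by
  simp only [offer, used_congr h]

theorem chosen_congr [NeZero d] {t : ℕ} (h : a t = b t) : chosen a t = chosen b t := by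
  simp only [chosen, rejects_congr h]

theorem roundLoad_congr [NeZero d] (z : Fin d → ℕ → Fin n) {t : ℕ} (h : ∀ k < t, a k = b k)
    (i : Fin d) (m : Fin n) : roundLoad a z i m t = roundLoad b z i m t := by
  unfold roundLoad
  congr 1
  refine Finset.filter_congr fun k hk => ?_
  have hk' := Finset.mem_range.1 hk
  simp only [finalBin, chosen_congr (h k hk'), offer_congr z fun l hl => h l (hl.trans hk')]

end Locality

theorem thresholdTable_eq {d n : ℕ} [NeZero d] (ℓ : ℝ) (z : Fin d → ℕ → Fin n) {t k : ℕ}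
    (h : k < t) : thresholdTable ℓ z t k = threshold ℓ z k := by
  induction t with
  | zero => omega
  | succ t ih =>
    rcases Nat.lt_succ_iff_lt_or_eq.1 h with h' | rfl
    · rw [thresholdTable, Function.update_of_ne h'.ne, ih h']
    · rfl

/-- The rule that defines the threshold strategy. -/
theorem threshold_eq {d n : ℕ} [NeZero d] (ℓ : ℝ) (z : Fin d → ℕ → Fin n) (t : ℕ)
    (i : Fin (d - 1)) :
    threshold ℓ z t i = decide (ℓ < (roundLoad (threshold ℓ z) z (toRound i)
      (offer (threshold ℓ z) z t (toRound i)) t : ℝ)) := by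
  have h : ∀ k < t, thresholdTable ℓ z t k = threshold ℓ z k :=
    fun k hk => thresholdTable_eq ℓ z hk
  rw [← roundLoad_congr z h, ← offer_congr z h]
  simp [threshold, thresholdTable]

/-! ### Random pools and thinning strategies -/

/-- The pools consist of independent, uniformly distributed random bins. -/
structure IsPool {Ω : Type*} [MeasurableSpace Ω] (P : Measure Ω) {d n : ℕ}
    (Z : Fin d → ℕ → Ω → Fin n) : Prop where
  measurable : ∀ i r, Measurable (Z i r)
  uniform : ∀ i r m, P {ω | Z i r ω = m} = (n : ENNReal)⁻¹
  indep : iIndepFun (fun p : Fin d × ℕ => Z p.1 p.2) P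

/-- The history of the process up to and including the decision on ball `t` in round `i`: it tells
which balls reached which rounds up to that moment, which bins were offered to them there, and
what was decided. -/
def history {Ω : Type*} {d n : ℕ} (Z : Fin d → ℕ → Ω → Fin n) (g : ℕ → Fin (d - 1) → Ω → Bool)
    (t : ℕ) (i : Fin d) (ω : Ω) : ℕ → Fin d → Fin n → Bool → Prop :=
  fun s j m b => (s < t ∨ s = t ∧ j ≤ i) ∧ reaches (fun k l => g k l ω) s j ∧
    offer (fun k l => g k l ω) (fun l r => Z l r ω) s j = m ∧
    rejects (fun k l => g k l ω) s j = b

/-- The future allocations at that moment: the unused parts of all pools. -/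
noncomputable def future {Ω : Type*} {d n : ℕ} (Z : Fin d → ℕ → Ω → Fin n)
    (g : ℕ → Fin (d - 1) → Ω → Bool) (t : ℕ) (i : Fin d) (ω : Ω) : Fin d → ℕ → Fin n :=
  fun j r => Z j (used (fun k l => g k l ω) (if j ≤ i then t + 1 else t) j + r) ω

/-- A `d`-thinning strategy, given by its random decisions: `g t i ω` is the decision on the
allocation offered to ball `t` in round `i`. A decision may depend on everything that happened so
far and on any external random data, as long as all of this is independent of the future
allocations. -/
structure IsStrategy {Ω : Type*} [MeasurableSpace Ω] (P : Measure Ω) {d n : ℕ}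
    (Z : Fin d → ℕ → Ω → Fin n) (g : ℕ → Fin (d - 1) → Ω → Bool) : Prop where
  measurable : ∀ t i, Measurable (g t i)
  indep_future : ∀ t i, IndepFun (history Z g t i) (future Z g t i) P

/-- The maximum load after `t` balls as a random variable. -/
noncomputable def MaxLoad {Ω : Type*} {d n : ℕ} [NeZero d] (Z : Fin d → ℕ → Ω → Fin n)
    (g : ℕ → Fin (d - 1) → Ω → Bool) (t : ℕ) (ω : Ω) : ℕ :=
  maxLoad (fun k l => g k l ω) (fun l r => Z l r ω) t

/-- The random decisions of the `ℓ`-threshold strategy. -/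
noncomputable def thresholdStrategy {Ω : Type*} {d n : ℕ} [NeZero d] (ℓ : ℝ)
    (Z : Fin d → ℕ → Ω → Fin n) : ℕ → Fin (d - 1) → Ω → Bool :=
  fun t i ω => threshold ℓ (fun l r => Z l r ω) t i

/-- For each number of bins `n ≥ 1` let pools `Z n` be given, and let `T n` balls be allocated. The
sequence `f` is asymptotically optimal if it consists of `d`-thinning strategies and, for every
sequence `g` of `d`-thinning strategies, with high probability the maximum load of `f` is at most
`1 + o(1)` times that of `g`. -/
def AsymptoticallyOptimal {Ω : ℕ+ → Type*} [∀ n, MeasurableSpace (Ω n)] (P : ∀ n, Measure (Ω n))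
    {d : ℕ} [NeZero d] (Z : ∀ n : ℕ+, Fin d → ℕ → Ω n → Fin n) (T : ℕ+ → ℕ)
    (f : ∀ n : ℕ+, ℕ → Fin (d - 1) → Ω n → Bool) : Prop :=
  (∀ n, IsStrategy (P n) (Z n) (f n)) ∧
  ∀ g : ∀ n : ℕ+, ℕ → Fin (d - 1) → Ω n → Bool, (∀ n, IsStrategy (P n) (Z n) (g n)) →
    ∃ ε : ℕ+ → ℝ, Tendsto ε atTop (𝓝 0) ∧
      Tendsto (fun n => P n {ω | (MaxLoad (Z n) (f n) (T n) ω : ℝ) ≤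
        (1 + ε n) * MaxLoad (Z n) (g n) (T n) ω}) atTop (𝓝 1)

/-- The threshold `(d log n / log log n) ^ (1 / d)`. -/
noncomputable def level (d : ℕ) (n : ℕ+) : ℝ :=
  (d * Real.log (n : ℝ) / Real.log (Real.log (n : ℝ))) ^ (1 / d : ℝ)

end Thinning

/-!
Let `ℓ = level d n`. Since `ℓ ^ d log ℓ ∼ log n` (`Thinning.tendsto_level_pow_mul_log`), it is
enough to show that for each fixed `ε > 0`, with high probability, the maximum load is at most `(d + ε) ℓ`
for the threshold strategy and at least `(d - ε) ℓ` for every strategy; an error `ε n → 0` is then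
found by a diagonal argument (`Thinning.exists_tendsto_zero`).

*Upper bound.* In each of the first `d - 1` rounds the threshold strategy places at most `⌊ℓ⌋ + 1`
balls into a bin, so only the last round matters. The balls rejected in a round are the surplus of
the bins over `⌊ℓ⌋ + 1` offers, which depends only on the number of elements of the pool that have
been used; if `n w` balls are offered a bin, at most `n (e w / K) ^ K` rejections are expected, with
`K = ⌊ℓ⌋ + 2` (`Thinning.IsPool.measure_le_sum_choose`). Thus the exponents
`-log w` grow like `ℓ ^ i log ℓ` with the number `i` of rounds, and a bin is offered `(1 + ε) ℓ`
balls in the last round with expected frequency `exp (-(1 + ε) ℓ ^ d log ℓ)`, which is `o (1 / n)`.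

*Lower bound.* The time is cut into boundedly many stages. If at the beginning of a stage there
are `n e ^ (-A)` bins of load at least `s`, and `n e ^ (-B)` balls of the stage reach round `i`,
then about `n e ^ (-A - h (B + log h))` of those bins are offered `h` times in round `i`. This uses
that the unused pools are independent of the history and have the law of the pools
(`Thinning.IsStrategy.map_future`), and Chebyshev's inequality for bins that occur in each of `h`
blocks, which are negatively correlated events (`Thinning.card_few_hits_le`). Either half of these
bins gain `h` balls, or half of them reject a ball, which reaches round `i + 1`
(`Thinning.card_hitHeavyBins_le`). As the last round admits no rejection, every stage has a round
in which the load is incremented by `h`. Recording the numbers `x i` of increments made in the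
rounds, and forgetting those in later rounds when round `i` is incremented, one obtains an odometer
that runs up to `∑ x i = J` in `(J + 1) ^ d` stages (`Thinning.exists_le_load`). The exponents stay
below `∏ ((x i + 1) h + 1)` times `log h + O(1)` (`Thinning.ballExp_add_le_prod`), which by the
inequality of arithmetic and geometric means is less than `log n` as long as `∑ x i < J`, where
`h J` is approximately `(d - ε) ℓ`.
-/

namespace Thinning

/-! ### The allocation process: counting balls and offers -/

section Counting

variable {d n : ℕ} (a : ℕ → Fin (d - 1) → Bool) (z : Fin d → ℕ → Fin n)

theorem reaches_zero (t : ℕ) : reaches a t 0 := fun _ h => absurd h (Nat.not_lt_zero _)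

theorem reaches_succ (t i : ℕ) :
    reaches a t (i + 1) ↔ reaches a t i ∧ rejects a t i = true := by
  simp only [reaches, Nat.lt_succ_iff_lt_or_eq]
  constructor
  · exact fun h => ⟨fun j hj => h j (Or.inl hj), h i (Or.inr rfl)⟩
  · rintro ⟨h, h'⟩ j (hj | rfl)
    exacts [h j hj, h']

theorem rejects_of_le {t i : ℕ} (h : d - 1 ≤ i) : rejects a t i = false := by
  simp [rejects, not_lt.2 h]

theorem rejects_toRound (t : ℕ) (i : Fin (d - 1)) : rejects a t i = a t i := by
  simp [rejects]

theorem not_reaches_of_le [NeZero d] {t i : ℕ} (h : d ≤ i) : ¬ reaches a t i := by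
  intro h'
  have hd := NeZero.pos d
  have := h' (d - 1) (by omega)
  rw [rejects_of_le a le_rfl] at this
  exact absurd this (by simp)

theorem used_zero (i : ℕ) : used a 0 i = 0 := by simp [used]

open Classical in
theorem used_succ (t i : ℕ) :
    used a (t + 1) i = used a t i + if reaches a t i then 1 else 0 := by
  unfold used
  rw [Finset.range_add_one, Finset.filter_insert]
  split_ifs with h
  · rw [Finset.card_insert_of_notMem (by simp)]
  · simp

theorem used_mono (i : ℕ) : Monotone fun t => used a t i :=
  monotone_nat_of_le_succ fun t => by rw [used_succ]; omega

theorem used_le (t i : ℕ) : used a t i ≤ t := by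
  induction t with
  | zero => simp [used]
  | succ t ih => rw [used_succ]; split_ifs <;> omega

theorem used_round_zero (t : ℕ) : used a t 0 = t := by
  induction t with
  | zero => simp [used]
  | succ t ih => rw [used_succ, ih, if_pos (reaches_zero a t)]

theorem used_lt_used {k t i : ℕ} (h : reaches a k i) (hk : k < t) :
    used a k i < used a t i := by
  have h1 := used_succ a k i
  rw [if_pos h] at h1
  have h2 : used a (k + 1) i ≤ used a t i := used_mono a i (Nat.succ_le_of_lt hk)
  omega

open Classical in
/-- The balls of a time interval that reach round `i` correspond one by one to the elements of the
pool of round `i` that are used up during this interval. -/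
theorem card_filter_reaches_Ico (i : ℕ) (Q : ℕ → Prop) {s t : ℕ} (hst : s ≤ t) :
    ((Finset.Ico s t).filter fun k => reaches a k i ∧ Q (used a k i)).card =
      ((Finset.Ico (used a s i) (used a t i)).filter Q).card := by
  induction t, hst using Nat.le_induction with
  | base => simp
  | succ t hst ih =>
    have hu : used a s i ≤ used a t i := used_mono a i hst
    rw [← Finset.insert_Ico_right_eq_Ico_add_one hst, Finset.filter_insert, used_succ]
    by_cases h : reaches a t i
    · rw [if_pos h, ← Finset.insert_Ico_right_eq_Ico_add_one hu, Finset.filter_insert]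
      by_cases hQ : Q (used a t i)
      · rw [if_pos ⟨h, hQ⟩, if_pos hQ, Finset.card_insert_of_notMem (by simp),
          Finset.card_insert_of_notMem (by simp), ih]
      · rw [if_neg (fun h => hQ h.2), if_neg hQ, ih]
    · rw [if_neg (fun h' => h h'.1), if_neg h, add_zero, ih]

theorem chosen_eq_iff [NeZero d] (t : ℕ) (i : Fin d) :
    chosen a t = i ↔ reaches a t i ∧ rejects a t i = false := by
  rw [chosen, Fin.ext_iff]
  simp only [Nat.find_eq_iff, reaches]
  simp only [Bool.not_eq_false, and_comm]

theorem finalBin_eq_iff [NeZero d] (t : ℕ) (m : Fin n) :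
    finalBin a z t = m ↔
      ∃ j : Fin d, reaches a t j ∧ offer a z t j = m ∧ rejects a t j = false := by
  constructor
  · intro h
    obtain ⟨h1, h2⟩ := (chosen_eq_iff a t _).1 rfl
    exact ⟨chosen a t, h1, h, h2⟩
  · rintro ⟨j, h1, h2, h3⟩
    rw [finalBin, (chosen_eq_iff a t j).2 ⟨h1, h3⟩, h2]

theorem chosen_and_finalBin_eq_iff [NeZero d] (t : ℕ) (i : Fin d) (m : Fin n) :
    (chosen a t = i ∧ finalBin a z t = m) ↔
      reaches a t i ∧ offer a z t i = m ∧ rejects a t i = false := by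
  constructor
  · rintro ⟨rfl, h⟩
    obtain ⟨h1, h2⟩ := (chosen_eq_iff a t _).1 rfl
    exact ⟨h1, h, h2⟩
  · rintro ⟨h1, h2, h3⟩
    have h := (chosen_eq_iff a t i).2 ⟨h1, h3⟩
    exact ⟨h, by rw [finalBin, h, h2]⟩

theorem load_mono [NeZero d] (m : Fin n) : Monotone fun t => load a z m t := fun _ _ h =>
  Finset.card_le_card (Finset.filter_subset_filter _ (Finset.range_mono h))

theorem load_le_maxLoad [NeZero d] (m : Fin n) (t : ℕ) : load a z m t ≤ maxLoad a z t :=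
  Finset.le_sup (f := fun m => load a z m t) (Finset.mem_univ m)

theorem load_eq_sum_roundLoad [NeZero d] (m : Fin n) (t : ℕ) :
    load a z m t = ∑ i : Fin d, roundLoad a z i m t := by
  unfold load roundLoad
  rw [Finset.card_eq_sum_card_fiberwise (f := fun k => chosen a k) (t := Finset.univ)
    (fun _ _ => Finset.mem_coe.2 (Finset.mem_univ _))]
  refine Finset.sum_congr rfl fun i _ => ?_
  rw [Finset.filter_filter]
  congr 1
  exact Finset.filter_congr fun k _ => and_comm

theorem roundLoad_mono [NeZero d] (i : Fin d) (m : Fin n) :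
    Monotone fun t => roundLoad a z i m t := fun _ _ h =>
  Finset.card_le_card (Finset.filter_subset_filter _ (Finset.range_mono h))

open Classical in
theorem roundLoad_succ [NeZero d] (i : Fin d) (m : Fin n) (t : ℕ) :
    roundLoad a z i m (t + 1) = roundLoad a z i m t +
      if reaches a t i ∧ offer a z t i = m ∧ rejects a t i = false then 1 else 0 := by
  unfold roundLoad
  rw [Finset.range_add_one, Finset.filter_insert]
  by_cases h : chosen a t = i ∧ finalBin a z t = m
  · rw [if_pos h, if_pos ((chosen_and_finalBin_eq_iff a z t i m).1 h),
      Finset.card_insert_of_notMem (by simp)]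
  · rw [if_neg h, if_neg (fun h' => h ((chosen_and_finalBin_eq_iff a z t i m).2 h')), add_zero]

/-- The number of occurrences of bin `m` among the first `u` elements of the pool of round `i`. -/
def poolCount (i : Fin d) (m : Fin n) (u : ℕ) : ℕ :=
  ((Finset.range u).filter fun r => z i r = m).card

theorem poolCount_mono (i : Fin d) (m : Fin n) : Monotone (poolCount z i m) := fun _ _ h =>
  Finset.card_le_card (Finset.filter_subset_filter _ (Finset.range_mono h))

open Classical in
/-- Among the first `t` balls, those that accept bin `m` in round `i` and those that reject it there
exhaust the occurrences of `m` in the used part of the pool. -/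
theorem roundLoad_add_rejected [NeZero d] (i : Fin d) (m : Fin n) (t : ℕ) :
    roundLoad a z i m t +
        ((Finset.range t).filter fun k => reaches a k (i + 1) ∧ offer a z k i = m).card =
      poolCount z i m (used a t i) := by
  have h1 := card_filter_reaches_Ico a i (fun r => z i r = m) (Nat.zero_le t)
  rw [used_zero, Nat.Ico_zero_eq_range, Nat.Ico_zero_eq_range] at h1
  have h2 : poolCount z i m (used a t i) =
      ((Finset.range t).filter fun k => reaches a k i ∧ z i (used a k i) = m).card := by
    rw [poolCount]
    convert h1.symm
  rw [h2, roundLoad]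
  simp only [chosen_and_finalBin_eq_iff]
  rw [← Finset.card_filter_add_card_filter_not (s := (Finset.range t).filter fun k =>
    reaches a k i ∧ z i (used a k i) = m) (fun k => rejects a k i = false),
    Finset.filter_filter, Finset.filter_filter]
  congr 2 <;> refine Finset.filter_congr fun k _ => ?_
  · simp only [offer]; tauto
  · simp only [offer, reaches_succ, Bool.not_eq_false]; tauto

end Counting

/-! ### The threshold strategy: pathwise bounds -/

section ThresholdBounds

variable {d n : ℕ} [NeZero d] {ℓ : ℝ} (z : Fin d → ℕ → Fin n)

theorem rejects_threshold (t : ℕ) (i : Fin d) (hi : (i : ℕ) < d - 1) :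
    rejects (threshold ℓ z) t i = true ↔
      ℓ < (roundLoad (threshold ℓ z) z i (offer (threshold ℓ z) z t i) t : ℝ) := by
  have h := rejects_toRound (threshold ℓ z) t ⟨i, hi⟩
  rw [threshold_eq] at h
  have hi' : toRound (⟨i, hi⟩ : Fin (d - 1)) = i := Fin.ext rfl
  rw [hi'] at h
  simpa using congrArg (· = true) h

/-- In every round but the last one a bin accepts at most `⌊ℓ⌋ + 1` balls. -/
theorem roundLoad_threshold_le (i : Fin d) (hi : (i : ℕ) < d - 1) (m : Fin n)
    (t : ℕ) : roundLoad (threshold ℓ z) z i m t ≤ ⌊ℓ⌋₊ + 1 := by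
  classical
  induction t with
  | zero => simp [roundLoad]
  | succ t ih =>
    rw [roundLoad_succ]
    split_ifs with h
    · obtain ⟨_, h2, h3⟩ := h
      have h4 := (rejects_threshold (ℓ := ℓ) z t i hi).not.1 (by simp [h3])
      rw [h2, not_lt] at h4
      have := Nat.le_floor h4
      omega
    · omega

/-- A bin that is rejected in round `i` has accepted more than `ℓ` balls there, so the rejections
of a bin number at most its surplus of occurrences over `⌊ℓ⌋ + 1`. -/
theorem used_threshold_succ_le (hℓ : 0 ≤ ℓ) (i : Fin d) (t : ℕ) :
    used (threshold ℓ z) t (i + 1) ≤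
      ∑ m, (poolCount z i m (used (threshold ℓ z) t i) - (⌊ℓ⌋₊ + 1)) := by
  classical
  unfold used
  rw [Finset.card_eq_sum_card_fiberwise (f := fun k => offer (threshold ℓ z) z k i)
    (t := Finset.univ) (fun _ _ => Finset.mem_coe.2 (Finset.mem_univ _))]
  refine Finset.sum_le_sum fun m _ => ?_
  rw [Finset.filter_filter]
  have key := roundLoad_add_rejected (threshold ℓ z) z i m t
  rcases Finset.eq_empty_or_nonempty ((Finset.range t).filter fun k =>
    reaches (threshold ℓ z) k (i + 1) ∧ offer (threshold ℓ z) z k i = m) with h | ⟨k, hk⟩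
  · rw [h]; simp
  · simp only [Finset.mem_filter, Finset.mem_range, reaches_succ] at hk
    obtain ⟨hkt, ⟨_, h2⟩, h3⟩ := hk
    have hi : (i : ℕ) < d - 1 := by
      by_contra hi
      rw [rejects_of_le _ (not_lt.1 hi)] at h2
      exact absurd h2 (by simp)
    rw [rejects_threshold z k i hi, h3] at h2
    have h4 : ⌊ℓ⌋₊ < roundLoad (threshold ℓ z) z i m k := (Nat.floor_lt hℓ).2 h2
    have h5 : roundLoad (threshold ℓ z) z i m k ≤ roundLoad (threshold ℓ z) z i m t :=
      roundLoad_mono _ z i m hkt.le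
    unfold used at key
    omega

theorem sub_le_choose_succ (x k : ℕ) : x - k ≤ x.choose (k + 1) := by
  induction x with
  | zero => simp
  | succ x ih =>
    rw [Nat.choose_succ_succ']
    rcases le_or_gt k x with h | h
    · have := Nat.choose_pos h
      omega
    · omega

/-- If the numbers `u i` bound the surplus in each round, they bound the number of balls that reach
the rounds. -/
theorem used_threshold_le (hℓ : 0 ≤ ℓ) (t : ℕ) (u : ℕ → ℕ) (h0 : t ≤ u 0)
    (hu : ∀ i : Fin d, (i : ℕ) < d - 1 →
      ∑ m, (poolCount z i m (u i)).choose (⌊ℓ⌋₊ + 2) ≤ u (i + 1)) (i : ℕ) (hi : i < d) :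
    used (threshold ℓ z) t i ≤ u i := by
  induction i with
  | zero => rwa [used_round_zero]
  | succ i ih =>
    refine (used_threshold_succ_le z hℓ ⟨i, by omega⟩ t).trans
      (le_trans (Finset.sum_le_sum fun m _ => ?_) (hu ⟨i, by omega⟩ (by simp; omega)))
    refine (sub_le_choose_succ _ _).trans (Nat.choose_le_choose _ ?_)
    exact poolCount_mono z _ m (ih (by omega))

theorem maxLoad_threshold_le (hℓ : 0 ≤ ℓ) (t : ℕ) (u : ℕ → ℕ) (h0 : t ≤ u 0)
    (hu : ∀ i : Fin d, (i : ℕ) < d - 1 →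
      ∑ m, (poolCount z i m (u i)).choose (⌊ℓ⌋₊ + 2) ≤ u (i + 1)) (s : ℕ)
    (hs : ∀ i : Fin d, (i : ℕ) = d - 1 → ∀ m, poolCount z i m (u i) ≤ s) :
    maxLoad (threshold ℓ z) z t ≤ (d - 1) * (⌊ℓ⌋₊ + 1) + s := by
  refine Finset.sup_le fun m _ => ?_
  have hd := NeZero.pos d
  rw [load_eq_sum_roundLoad]
  let l : Fin d := ⟨d - 1, by omega⟩
  rw [← Finset.sum_erase_add _ _ (Finset.mem_univ l)]
  refine add_le_add ?_ ?_
  · refine (Finset.sum_le_card_nsmul _ _ (⌊ℓ⌋₊ + 1) fun i hi => ?_).trans ?_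
    · have : i ≠ l := Finset.ne_of_mem_erase hi
      have h2 : (i : ℕ) ≠ d - 1 := fun h => this (Fin.ext h)
      exact roundLoad_threshold_le z i (by omega) m t
    · rw [Finset.card_erase_of_mem (Finset.mem_univ l), Finset.card_univ, Fintype.card_fin,
        smul_eq_mul]
  · refine le_trans ?_ (hs l rfl m)
    have h1 := roundLoad_add_rejected (threshold ℓ z) z l m t
    have h2 := poolCount_mono z l m (used_threshold_le z hℓ t u h0 hu l l.2)
    omega

end ThresholdBounds

/-! ### Independent uniform pools -/

section Pools

variable {Ω : Type*} [MeasurableSpace Ω] {P : Measure Ω} {d n : ℕ} {Z : Fin d → ℕ → Ω → Fin n}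

/-- Removing a fixed number of elements from the front of each pool does not change the joint law of
the pools. -/
theorem IsPool.map_shift [IsProbabilityMeasure P] (hZ : IsPool P Z) (v : Fin d → ℕ) :
    P.map (fun ω j r => Z j (v j + r) ω) = P.map (fun ω j r => Z j r ω) := by
  have hmarg : ∀ i j r s, P.map (Z i r) = P.map (Z j s) := by
    intro i j r s
    refine Measure.ext_of_singleton fun m => ?_
    rw [Measure.map_apply (hZ.measurable i r) (measurableSet_singleton m),
      Measure.map_apply (hZ.measurable j s) (measurableSet_singleton m)]
    exact (hZ.uniform i r m).trans (hZ.uniform j s m).symm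
  let g : Fin d × ℕ → Fin d × ℕ := fun p => (p.1, v p.1 + p.2)
  have hg : Function.Injective g := by
    rintro ⟨i, r⟩ ⟨j, s⟩ h
    simp only [g, Prod.mk.injEq] at h
    obtain ⟨rfl, h⟩ := h
    simp only [Prod.mk.injEq, true_and]
    omega
  have h1 := (iIndepFun_iff_map_fun_eq_infinitePi_map fun p : Fin d × ℕ =>
    hZ.measurable p.1 p.2).1 hZ.indep
  have h2 := (iIndepFun_iff_map_fun_eq_infinitePi_map fun p : Fin d × ℕ =>
    hZ.measurable (g p).1 (g p).2).1 (hZ.indep.precomp hg)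
  have h3 : (fun p : Fin d × ℕ => P.map (Z (g p).1 (g p).2)) = fun p => P.map (Z p.1 p.2) :=
    funext fun p => hmarg _ _ _ _
  rw [h3, ← h1] at h2
  have hc : Measurable fun (y : Fin d × ℕ → Fin n) (j : Fin d) (r : ℕ) => y (j, r) :=
    measurable_pi_lambda _ fun j => measurable_pi_lambda _ fun r => measurable_pi_apply _
  have h4 := congrArg (Measure.map fun (y : Fin d × ℕ → Fin n) (j : Fin d) (r : ℕ) => y (j, r)) h2
  rw [Measure.map_map hc (measurable_pi_lambda _ fun p => hZ.measurable _ _),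
    Measure.map_map hc (measurable_pi_lambda _ fun p => hZ.measurable _ _)] at h4
  exact h4

theorem IsPool.measurable_pools (hZ : IsPool P Z) : Measurable fun ω j r => Z j r ω :=
  measurable_pi_lambda _ fun j => measurable_pi_lambda _ fun r => hZ.measurable j r

theorem IsPool.measure_forall_mem_eq (hZ : IsPool P Z) (i : Fin d) (m : Fin n) (S : Finset ℕ) :
    P {ω | ∀ r ∈ S, Z i r ω = m} = ((n : ENNReal)⁻¹) ^ S.card := by
  have h := hZ.indep.precomp (g := fun r : ℕ => (i, r)) (fun r s h => (Prod.mk.inj h).2)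
  have h2 := h.measure_inter_preimage_eq_mul S (sets := fun _ => {m})
    (fun _ _ => measurableSet_singleton m)
  have h3 : {ω | ∀ r ∈ S, Z i r ω = m} = ⋂ r ∈ S, Z i r ⁻¹' {m} := by ext; simp
  rw [h3]
  exact h2.trans ((Finset.prod_congr rfl fun r _ => hZ.uniform i r m).trans (Finset.prod_const _))

theorem choose_poolCount (z : Fin d → ℕ → Fin n) (i : Fin d) (m : Fin n) (u s : ℕ) :
    (poolCount z i m u).choose s =
      ∑ S ∈ (Finset.range u).powersetCard s, if ∀ r ∈ S, z i r = m then 1 else 0 := by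
  rw [poolCount, ← Finset.card_powersetCard, Finset.sum_boole, Nat.cast_id]
  congr 1
  ext S
  simp only [Finset.mem_powersetCard, Finset.mem_filter, Finset.subset_iff]
  constructor
  · rintro ⟨h1, h2⟩
    exact ⟨⟨fun r hr => (h1 hr).1, h2⟩, fun r hr => (h1 hr).2⟩
  · rintro ⟨⟨h1, h2⟩, h3⟩
    exact ⟨fun r hr => ⟨h1 hr, h3 r hr⟩, h2⟩

theorem IsPool.lintegral_sum_choose (hZ : IsPool P Z) (i : Fin d) (u s : ℕ) :
    ∫⁻ ω, ((∑ m, (poolCount (fun l r => Z l r ω) i m u).choose s : ℕ) : ENNReal) ∂P =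
      n * u.choose s * ((n : ENNReal)⁻¹) ^ s := by
  have hm : ∀ (S : Finset ℕ) (m : Fin n), MeasurableSet {ω | ∀ r ∈ S, Z i r ω = m} := by
    intro S m
    have h3 : {ω | ∀ r ∈ S, Z i r ω = m} = ⋂ r ∈ S, Z i r ⁻¹' {m} := by ext; simp
    rw [h3]
    exact S.measurableSet_biInter fun r _ => hZ.measurable i r (measurableSet_singleton m)
  have hi : ∀ (S : Finset ℕ) (m : Fin n) ω,
      ((if ∀ r ∈ S, Z i r ω = m then 1 else 0 : ℕ) : ENNReal) =
        {ω | ∀ r ∈ S, Z i r ω = m}.indicator 1 ω := by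
    intro S m ω
    by_cases h : ∀ r ∈ S, Z i r ω = m
    · rw [if_pos h, Set.indicator_of_mem (by exact h)]; simp
    · rw [if_neg h, Set.indicator_of_notMem (by exact h)]; simp
  simp only [choose_poolCount, Nat.cast_sum, hi]
  rw [lintegral_finsetSum _ fun m _ => Finset.measurable_fun_sum _ fun S _ =>
    measurable_one.indicator (hm S m)]
  have : ∀ m : Fin n, ∫⁻ ω, ∑ S ∈ (Finset.range u).powersetCard s,
      {ω | ∀ r ∈ S, Z i r ω = m}.indicator (1 : Ω → ENNReal) ω ∂P =
        u.choose s * ((n : ENNReal)⁻¹) ^ s := by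
    intro m
    rw [lintegral_finsetSum _ fun S _ => measurable_one.indicator (hm S m)]
    rw [Finset.sum_congr rfl (g := fun _ => ((n : ENNReal)⁻¹) ^ s), Finset.sum_const,
      Finset.card_powersetCard, Finset.card_range, nsmul_eq_mul]
    intro S hS
    rw [lintegral_indicator_one (hm S m), hZ.measure_forall_mem_eq,
      (Finset.mem_powersetCard.1 hS).2]
  rw [Finset.sum_congr rfl fun m _ => this m, Finset.sum_const, Finset.card_univ,
    Fintype.card_fin, nsmul_eq_mul, mul_assoc]

/-- The first moment bound: `∑ m, (N m).choose s`, where `N m` is the number of occurrences of bin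
`m` among `u ≤ n w` pool elements, has expectation at most `n (e w / s) ^ s`. -/
theorem IsPool.measure_le_sum_choose (hZ : IsPool P Z) (hn : 0 < n) (i : Fin d) {u s : ℕ}
    (hs : 0 < s) {w D : ℝ} (hu : u ≤ n * w) (hD : 0 < D) :
    P {ω | D ≤ ((∑ m, (poolCount (fun l r => Z l r ω) i m u).choose s : ℕ) : ℝ)} ≤
      ENNReal.ofReal (n * (Real.exp 1 * w / s) ^ s / D) := by
  have hn' : (0 : ℝ) < n := Nat.cast_pos.2 hn
  have hs' : (0 : ℝ) < s := Nat.cast_pos.2 hs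
  have hw : 0 ≤ w := by
    by_contra h
    have h2 : (n : ℝ) * w < 0 := mul_neg_of_pos_of_neg hn' (not_le.1 h)
    have h3 : (0 : ℝ) ≤ u := Nat.cast_nonneg u
    linarith
  have hmeas : Measurable fun ω =>
      ((∑ m, (poolCount (fun l r => Z l r ω) i m u).choose s : ℕ) : ENNReal) := by
    have h1 : Measurable fun ω => ∑ m, (poolCount (fun l r => Z l r ω) i m u).choose s := by
      refine Finset.measurable_fun_sum _ fun m _ => ?_
      simp only [choose_poolCount]
      refine Finset.measurable_fun_sum _ fun S _ => ?_
      refine Measurable.ite ?_ measurable_const measurable_const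
      have h3 : {ω | ∀ r ∈ S, Z i r ω = m} = ⋂ r ∈ S, Z i r ⁻¹' {m} := by ext; simp
      rw [h3]
      exact S.measurableSet_biInter fun r _ => hZ.measurable i r (measurableSet_singleton m)
    exact measurable_from_nat.comp h1
  have hset : {ω | D ≤ ((∑ m, (poolCount (fun l r => Z l r ω) i m u).choose s : ℕ) : ℝ)} =
      {ω | ENNReal.ofReal D ≤
        ((∑ m, (poolCount (fun l r => Z l r ω) i m u).choose s : ℕ) : ENNReal)} := by
    ext ω
    rw [Set.mem_ofPred_eq, Set.mem_ofPred_eq, ← ENNReal.ofReal_natCast,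
      ENNReal.ofReal_le_ofReal_iff (Nat.cast_nonneg _)]
  rw [hset]
  refine (meas_ge_le_lintegral_div hmeas.aemeasurable
    (ENNReal.ofReal_pos.2 hD).ne' ENNReal.ofReal_ne_top).trans ?_
  rw [hZ.lintegral_sum_choose, ENNReal.ofReal_div_of_pos hD]
  refine ENNReal.div_le_div_right ?_ _
  have e1 : ((n : ENNReal) * u.choose s * ((n : ENNReal)⁻¹) ^ s) =
      ENNReal.ofReal (n * u.choose s * ((n : ℝ)⁻¹) ^ s) := by
    rw [ENNReal.ofReal_mul (by positivity), ENNReal.ofReal_mul (by positivity),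
      ENNReal.ofReal_pow (by positivity), ENNReal.ofReal_inv_of_pos hn', ENNReal.ofReal_natCast,
      ENNReal.ofReal_natCast]
  rw [e1]
  refine ENNReal.ofReal_le_ofReal ?_
  rw [mul_assoc]
  refine mul_le_mul_of_nonneg_left ?_ hn'.le
  have h1 : ((u.choose s : ℕ) : ℝ) ≤ (n * w) ^ s / s.factorial :=
    (Nat.choose_le_pow_div s u).trans (by gcongr)
  have h2 : (s : ℝ) ^ s / s.factorial ≤ Real.exp 1 ^ s := by
    rw [← Real.exp_nat_mul, mul_one]
    exact Real.pow_div_factorial_le_exp s hs'.le s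
  have hf : (0 : ℝ) < s.factorial := Nat.cast_pos.2 s.factorial_pos
  calc ((u.choose s : ℕ) : ℝ) * ((n : ℝ)⁻¹) ^ s
      ≤ (n * w) ^ s / s.factorial * ((n : ℝ)⁻¹) ^ s := by gcongr
    _ = (w / s) ^ s * ((s : ℝ) ^ s / s.factorial) := by
        rw [div_pow, mul_pow, inv_pow]; field_simp
    _ ≤ (w / s) ^ s * Real.exp 1 ^ s := by gcongr
    _ = (Real.exp 1 * w / s) ^ s := by rw [← mul_pow]; congr 1; ring

end Pools

/-! ### The second moment: bins that are hit in every block -/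

section SecondMoment

/-- The words consist of `h` blocks of length `b`; bin `m` is hit by a word if it occurs in each of
the blocks. In contrast to "bin `m` occurs at least `h` times", these events are visibly negatively
correlated for different bins. -/
def Hits {n h b : ℕ} (v : Fin h → Fin b → Fin n) (m : Fin n) : Prop := ∀ c, ∃ r, v c r = m

instance {n h b : ℕ} (v : Fin h → Fin b → Fin n) : DecidablePred (Hits v) :=
  fun m => inferInstanceAs (Decidable (∀ c, ∃ r, v c r = m))

variable {n : ℕ}

theorem card_forall_block (h b : ℕ) (Q : (Fin b → Fin n) → Prop) [DecidablePred Q] :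
    (Finset.univ.filter fun v : Fin h → Fin b → Fin n => ∀ c, Q (v c)).card =
      (Finset.univ.filter Q).card ^ h := by
  rw [← Finset.card_fin h, ← Finset.prod_const, Finset.card_fin, ← Fintype.card_piFinset]
  congr 1
  ext v
  simp [Fintype.mem_piFinset]

theorem card_avoid (b : ℕ) (A : Finset (Fin n)) :
    (Finset.univ.filter fun y : Fin b → Fin n => ∀ r, y r ∉ A).card = (n - A.card) ^ b := by
  rw [← Finset.card_fin b, ← Finset.prod_const, Finset.card_fin]
  have : (n - A.card) = (Aᶜ).card := by rw [Finset.card_compl, Fintype.card_fin]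
  rw [this, Finset.prod_const, ← Finset.prod_const, ← Fintype.card_piFinset]
  congr 1
  ext v
  simp [Fintype.mem_piFinset]

/-- The probability that a fixed bin occurs in a block of length `b`. -/
noncomputable def hitProb (n b : ℕ) : ℝ := 1 - (1 - 1 / n) ^ b

theorem hitProb_nonneg (hn : 0 < n) (b : ℕ) : 0 ≤ hitProb n b := by
  have h1 : (1 : ℝ) ≤ n := Nat.one_le_cast.2 hn
  have h2 : (1 : ℝ) / n ≤ 1 := by rw [div_le_one (by linarith)]; exact h1
  have h3 : (0 : ℝ) ≤ 1 / n := by positivity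
  have := pow_le_one₀ (n := b) (sub_nonneg.2 h2) (by linarith)
  unfold hitProb
  linarith

theorem card_hit_block (hn : 0 < n) (b : ℕ) (m : Fin n) :
    ((Finset.univ.filter fun y : Fin b → Fin n => ∃ r, y r = m).card : ℝ) =
      (n : ℝ) ^ b * hitProb n b := by
  have hn' : (n : ℝ) ≠ 0 := Nat.cast_ne_zero.2 hn.ne'
  have h1 := card_avoid b ({m} : Finset (Fin n))
  have h2 := Finset.card_filter_add_card_filter_not (s := (Finset.univ : Finset (Fin b → Fin n)))
    (fun y => ∃ r, y r = m)
  simp only [not_exists, Finset.mem_singleton, Finset.card_singleton] at h1 h2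
  rw [h1, Finset.card_univ, Fintype.card_fun, Fintype.card_fin, Fintype.card_fin] at h2
  have h3 : ((Finset.univ.filter fun y : Fin b → Fin n => ∃ r, y r = m).card : ℝ) +
      ((n : ℝ) - 1) ^ b = (n : ℝ) ^ b := by
    have := congrArg (Nat.cast : ℕ → ℝ) h2
    push_cast [Nat.cast_sub (Nat.one_le_iff_ne_zero.2 hn.ne')] at this
    exact this
  have h4 : ((n : ℝ) - 1) ^ b = (n : ℝ) ^ b * (1 - 1 / n) ^ b := by
    rw [← mul_pow]; congr 1; field_simp
  unfold hitProb
  linarith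

theorem card_hit_block_two_le (b : ℕ) {m m' : Fin n} (hm : m ≠ m') :
    ((Finset.univ.filter fun y : Fin b → Fin n => (∃ r, y r = m) ∧ ∃ r, y r = m').card : ℝ) ≤
      (n : ℝ) ^ b * hitProb n b ^ 2 := by
  have hn : 2 ≤ n := by
    have := Finset.card_le_univ ({m, m'} : Finset (Fin n))
    rwa [Finset.card_pair hm, Fintype.card_fin] at this
  have hn' : (n : ℝ) ≠ 0 := Nat.cast_ne_zero.2 (by omega)
  have hn2 : (2 : ℝ) ≤ n := by exact_mod_cast hn
  have h1 := card_avoid b ({m, m'} : Finset (Fin n))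
  have h2 := card_hit_block (by omega) b m
  have h2' := card_hit_block (by omega) b m'
  have h3 := Finset.card_union_add_card_inter
    (Finset.univ.filter fun y : Fin b → Fin n => ∃ r, y r = m)
    (Finset.univ.filter fun y : Fin b → Fin n => ∃ r, y r = m')
  rw [← Finset.filter_or, ← Finset.filter_and] at h3
  have h4 := Finset.card_filter_add_card_filter_not (s := (Finset.univ : Finset (Fin b → Fin n)))
    (fun y => (∃ r, y r = m) ∨ ∃ r, y r = m')
  have h5 : (Finset.univ.filter fun y : Fin b → Fin n => ¬((∃ r, y r = m) ∨ ∃ r, y r = m')) =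
      Finset.univ.filter fun y : Fin b → Fin n => ∀ r, y r ∉ ({m, m'} : Finset (Fin n)) := by
    refine Finset.filter_congr fun y _ => ?_
    simp only [Finset.mem_insert, Finset.mem_singleton, not_or, not_exists]
    exact ⟨fun h r => ⟨h.1 r, h.2 r⟩, fun h => ⟨fun r => (h r).1, fun r => (h r).2⟩⟩
  rw [h5, h1, Finset.card_pair hm, Finset.card_univ, Fintype.card_fun, Fintype.card_fin,
    Fintype.card_fin] at h4
  have h6 : ((Finset.univ.filter fun y : Fin b → Fin n =>
      (∃ r, y r = m) ∨ ∃ r, y r = m').card : ℝ) + ((n : ℝ) - 2) ^ b = (n : ℝ) ^ b := by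
    have := congrArg (Nat.cast : ℕ → ℝ) h4
    push_cast [Nat.cast_sub hn] at this
    exact this
  have h7 := congrArg (Nat.cast : ℕ → ℝ) h3
  push_cast at h7
  -- The negative correlation comes down to `1 - 2 / n ≤ (1 - 1 / n) ^ 2`.
  have h8 : ((n : ℝ) - 2) ^ b ≤ (n : ℝ) ^ b * ((1 - 1 / n) ^ b) ^ 2 := by
    rw [← pow_mul, mul_comm b 2, pow_mul, ← mul_pow]
    refine pow_le_pow_left₀ (by linarith) ?_ b
    have : (n : ℝ) * (1 - 1 / n) ^ 2 = n - 2 + 1 / n := by field_simp; ring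
    rw [this]
    have : (0 : ℝ) ≤ 1 / n := by positivity
    linarith
  unfold hitProb at *
  nlinarith

theorem card_hits (hn : 0 < n) (h b : ℕ) (m : Fin n) :
    ((Finset.univ.filter fun v : Fin h → Fin b → Fin n => Hits v m).card : ℝ) =
      ((n : ℝ) ^ b) ^ h * hitProb n b ^ h := by
  have := card_forall_block h b (fun y : Fin b → Fin n => ∃ r, y r = m)
  rw [← mul_pow, ← card_hit_block hn b m]
  exact_mod_cast this

theorem card_hits_two_le (h b : ℕ) {m m' : Fin n} (hm : m ≠ m') :
    ((Finset.univ.filter fun v : Fin h → Fin b → Fin n => Hits v m ∧ Hits v m').card : ℝ) ≤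
      ((n : ℝ) ^ b) ^ h * (hitProb n b ^ h) ^ 2 := by
  have h1 := card_forall_block h b (fun y : Fin b → Fin n => (∃ r, y r = m) ∧ ∃ r, y r = m')
  have h2 : (Finset.univ.filter fun v : Fin h → Fin b → Fin n => Hits v m ∧ Hits v m') =
      Finset.univ.filter fun v : Fin h → Fin b → Fin n =>
        ∀ c, (∃ r, v c r = m) ∧ ∃ r, v c r = m' :=
    Finset.filter_congr fun v _ => forall_and.symm
  have h3 : ((n : ℝ) ^ b) ^ h * (hitProb n b ^ h) ^ 2 = ((n : ℝ) ^ b * hitProb n b ^ 2) ^ h := by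
    rw [mul_pow, pow_right_comm (hitProb n b)]
  rw [h2, h1, h3]
  push_cast
  exact pow_le_pow_left₀ (Nat.cast_nonneg _) (card_hit_block_two_le b hm) h

/-- Chebyshev's inequality for the number of bins of `A` that are hit by a uniformly random word:
by negative correlation the variance is at most the mean `μ`, so that a proportion of at most
`4 / μ` of all words hits less than `μ / 2` bins of `A`. -/
theorem card_few_hits_le (hn : 0 < n) (h b : ℕ) (A : Finset (Fin n))
    {μ : ℝ} (hμ : μ = A.card * hitProb n b ^ h) (hpos : 0 < μ) :
    ((Finset.univ.filter fun v : Fin h → Fin b → Fin n =>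
      ((A.filter fun m => Hits v m).card : ℝ) < μ / 2).card : ℝ) ≤
      ((n : ℝ) ^ b) ^ h * (4 / μ) := by
  set V : ℝ := ((n : ℝ) ^ b) ^ h with hV
  set p := hitProb n b ^ h with hp
  have hp0 : 0 ≤ p := pow_nonneg (hitProb_nonneg hn b) h
  have hV0 : 0 ≤ V := by positivity
  let I : (Fin h → Fin b → Fin n) → Fin n → ℝ := fun v m => if Hits v m then 1 else 0
  have hX : ∀ v, ((A.filter fun m => Hits v m).card : ℝ) = ∑ m ∈ A, I v m := by
    intro v; simp [I]
  have hVc : ∑ _v : Fin h → Fin b → Fin n, (1 : ℝ) = V := by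
    simp [hV]
  have h1 : ∀ m, ∑ v, I v m = V * p := by
    intro m
    rw [← card_hits hn h b m]; simp [I]
  have h2 : ∀ m m', ∑ v, I v m * I v m' ≤ V * p ^ 2 + if m = m' then V * p else 0 := by
    intro m m'
    split_ifs with hm
    · subst hm
      have : ∀ v, I v m * I v m = I v m := by
        intro v; simp only [I]; split_ifs <;> simp
      simp only [this, h1]
      have : 0 ≤ V * p ^ 2 := by positivity
      linarith
    · rw [add_zero, hp]
      refine le_of_eq_of_le ?_ (card_hits_two_le h b hm)
      rw [Finset.natCast_card_filter]
      refine Finset.sum_congr rfl fun v _ => ?_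
      simp only [I]
      split_ifs <;> simp_all
  have hsq : ∑ v, (∑ m ∈ A, I v m - μ) ^ 2 ≤ V * μ := by
    have e1 : ∀ v, (∑ m ∈ A, I v m - μ) ^ 2 =
        ∑ m ∈ A, ∑ m' ∈ A, I v m * I v m' - 2 * μ * ∑ m ∈ A, I v m + μ ^ 2 * 1 := by
      intro v
      rw [← Finset.sum_mul_sum]; ring
    simp only [e1]
    rw [Finset.sum_add_distrib, Finset.sum_sub_distrib, ← Finset.mul_sum, ← Finset.mul_sum, hVc,
      Finset.sum_comm, Finset.sum_comm (s := Finset.univ) (t := A)]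
    have e2 : ∑ m ∈ A, ∑ v, ∑ m' ∈ A, I v m * I v m' ≤
        A.card * (A.card * (V * p ^ 2) + V * p) := by
      rw [← nsmul_eq_mul]
      refine Finset.sum_le_card_nsmul _ _ _ fun m hm => ?_
      rw [Finset.sum_comm]
      refine (Finset.sum_le_sum fun m' _ => h2 m m').trans ?_
      rw [Finset.sum_add_distrib, Finset.sum_const, nsmul_eq_mul, Finset.sum_ite_eq, if_pos hm]
    have e3 : ∑ m ∈ A, ∑ v, I v m = A.card * (V * p) := by
      rw [Finset.sum_congr rfl fun m _ => h1 m, Finset.sum_const, nsmul_eq_mul]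
    rw [e3]
    have : (A.card : ℝ) * (A.card * (V * p ^ 2) + V * p) - 2 * μ * (A.card * (V * p)) + μ ^ 2 * V =
      V * μ := by rw [hμ]; ring
    linarith
  have hcheb : ((Finset.univ.filter fun v : Fin h → Fin b → Fin n =>
      ((A.filter fun m => Hits v m).card : ℝ) < μ / 2).card : ℝ) * (μ / 2) ^ 2 ≤ V * μ := by
    refine le_trans ?_ hsq
    rw [← nsmul_eq_mul]
    refine (Finset.card_nsmul_le_sum _ (fun v => (∑ m ∈ A, I v m - μ) ^ 2) _ fun v hv => ?_).trans
      (Finset.sum_le_sum_of_subset_of_nonneg (Finset.subset_univ _) fun v _ _ => sq_nonneg _)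
    have hv' := (Finset.mem_filter.1 hv).2
    rw [hX] at hv'
    nlinarith
  have : V * (4 / μ) = V * μ / (μ / 2) ^ 2 := by field_simp; norm_num
  rw [this, le_div_iff₀ (by positivity)]
  exact hcheb

theorem le_hitProb (hn : 0 < n) {b : ℕ} (hb : b ≤ n) : (b : ℝ) / (2 * n) ≤ hitProb n b := by
  have hn' : (0 : ℝ) < n := Nat.cast_pos.2 hn
  set x : ℝ := b / n with hx
  have hx0 : 0 ≤ x := by positivity
  have hx1 : x ≤ 1 := by rw [hx, div_le_one hn']; exact_mod_cast hb
  have h1 : (1 - 1 / (n : ℝ)) ^ b ≤ Real.exp (-x) := by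
    have h2 : 1 - 1 / (n : ℝ) ≤ Real.exp (-(1 / n)) := by
      have := Real.add_one_le_exp (-(1 / (n : ℝ))); linarith
    have h3 : (0 : ℝ) ≤ 1 - 1 / n := by
      rw [sub_nonneg, div_le_one hn']; exact_mod_cast hn
    refine (pow_le_pow_left₀ h3 h2 b).trans (le_of_eq ?_)
    rw [← Real.exp_nat_mul, hx]; congr 1; ring
  have h4 : Real.exp (-x) ≤ 1 - x / 2 := by
    have h5 : (1 - x / 2) * Real.exp x ≥ 1 := by
      have := Real.add_one_le_exp x
      nlinarith
    rw [Real.exp_neg, inv_le_comm₀ (Real.exp_pos x) (by linarith)]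
    rw [inv_le_iff_one_le_mul₀ (by linarith)]
    linarith
  have h6 : (b : ℝ) / (2 * n) = x / 2 := by rw [hx]; ring
  unfold hitProb
  linarith

end SecondMoment

section

variable {Ω : Type*} [MeasurableSpace Ω] {P : Measure Ω} {d n : ℕ} {Z : Fin d → ℕ → Ω → Fin n}

/-- The first `h * b` elements of a sequence, cut into `h` blocks of length `b`. -/
def blocks (h b : ℕ) {α : Type*} (y : ℕ → α) (c : Fin h) (r : Fin b) : α := y (c * b + r)

theorem injective_block_index (h b : ℕ) :
    Function.Injective fun p : Fin h × Fin b => (p.1 : ℕ) * b + p.2 := by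
  rintro ⟨c, r⟩ ⟨c', r'⟩ hp
  have h1 : (c : ℕ) * b + r = c' * b + r' := hp
  have hb : 0 < b := r.pos
  have h2 : (c : ℕ) = c' := by
    have := congrArg (· / b) h1
    simp only [mul_comm _ b, Nat.mul_add_div hb, Nat.div_eq_of_lt r.2, Nat.div_eq_of_lt r'.2,
      add_zero] at this
    exact this
  have h3 : (r : ℕ) = r' := by rw [h2] at h1; omega
  exact Prod.ext (Fin.ext h2) (Fin.ext h3)

theorem IsPool.measure_blocks_eq (hZ : IsPool P Z) (i : Fin d) (h b : ℕ)
    (v : Fin h → Fin b → Fin n) :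
    P {ω | blocks h b (fun r => Z i r ω) = v} = (((n : ENNReal) ^ b) ^ h)⁻¹ := by
  have hinj : Function.Injective fun p : Fin h × Fin b => (i, (p.1 : ℕ) * b + p.2) :=
    fun p q hpq => injective_block_index h b (Prod.mk.inj hpq).2
  have h2 := (hZ.indep.precomp hinj).measure_inter_preimage_eq_mul Finset.univ
    (sets := fun p => {v p.1 p.2}) (fun _ _ => measurableSet_singleton _)
  have h3 : {ω | blocks h b (fun r => Z i r ω) = v} =
      ⋂ p ∈ (Finset.univ : Finset (Fin h × Fin b)),
        Z i ((p.1 : ℕ) * b + p.2) ⁻¹' {v p.1 p.2} := by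
    ext ω
    simp only [funext_iff, blocks, Set.mem_ofPred_eq, Finset.mem_univ, Set.iInter_true,
      Set.mem_iInter, Set.mem_preimage, Set.mem_singleton_iff, Prod.forall]
  rw [h3]
  refine h2.trans ((Finset.prod_congr rfl fun p _ => hZ.uniform i _ _).trans ?_)
  rw [Finset.prod_const, Finset.card_univ, Fintype.card_prod, Fintype.card_fin, Fintype.card_fin,
    ENNReal.inv_pow, ENNReal.inv_pow, ← pow_mul, mul_comm]

theorem IsPool.measure_few_hits_le (hZ : IsPool P Z) (hn : 0 < n) (i : Fin d) (h b : ℕ)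
    (A : Finset (Fin n)) {μ : ℝ} (hμ : μ = A.card * hitProb n b ^ h) (hpos : 0 < μ) :
    P {ω | ((A.filter fun m => Hits (blocks h b fun r => Z i r ω) m).card : ℝ) < μ / 2} ≤
      ENNReal.ofReal (4 / μ) := by
  have hn' : (0 : ℝ) < n := Nat.cast_pos.2 hn
  set S := Finset.univ.filter fun v : Fin h → Fin b → Fin n =>
      ((A.filter fun m => Hits v m).card : ℝ) < μ / 2 with hS
  have h1 : {ω | ((A.filter fun m => Hits (blocks h b fun r => Z i r ω) m).card : ℝ) < μ / 2} =
      ⋃ v ∈ S, {ω | blocks h b (fun r => Z i r ω) = v} := by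
    ext ω
    simp [hS]
  rw [h1]
  refine (measure_biUnion_finset_le _ _).trans ?_
  rw [Finset.sum_congr rfl fun v _ => hZ.measure_blocks_eq i h b v, Finset.sum_const,
    nsmul_eq_mul]
  have h2 := card_few_hits_le hn h b A hμ hpos
  have h3 : ((S.card : ENNReal) * (((n : ENNReal) ^ b) ^ h)⁻¹) =
      ENNReal.ofReal (S.card * (((n : ℝ) ^ b) ^ h)⁻¹) := by
    rw [ENNReal.ofReal_mul (by positivity), ENNReal.ofReal_inv_of_pos (by positivity),
      ENNReal.ofReal_pow (by positivity), ENNReal.ofReal_pow (by positivity),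
      ENNReal.ofReal_natCast, ENNReal.ofReal_natCast]
  rw [h3]
  refine ENNReal.ofReal_le_ofReal ?_
  rw [← div_eq_mul_inv, div_le_iff₀ (by positivity), mul_comm]
  exact h2

end

/-! ### The threshold strategy is a strategy -/

section ThresholdLocality

variable {d n : ℕ} [NeZero d] {ℓ : ℝ} {z z' : Fin d → ℕ → Fin n}

theorem roundLoad_congr_of_agree {a a' : ℕ → Fin (d - 1) → Bool} {t : ℕ}
    (h : ∀ k < t, ∀ j : Fin d, (reaches a k j ↔ reaches a' k j) ∧
      (reaches a k j → offer a z k j = offer a' z' k j ∧ rejects a k j = rejects a' k j))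
    (i : Fin d) (m : Fin n) : roundLoad a z i m t = roundLoad a' z' i m t := by
  classical
  unfold roundLoad
  congr 1
  refine Finset.filter_congr fun k hk => ?_
  obtain ⟨h1, h2⟩ := h k (Finset.mem_range.1 hk) i
  rw [chosen_and_finalBin_eq_iff, chosen_and_finalBin_eq_iff]
  constructor
  · rintro ⟨h3, h4, h5⟩
    rw [(h2 h3).1] at h4
    rw [(h2 h3).2] at h5
    exact ⟨h1.1 h3, h4, h5⟩
  · rintro ⟨h3, h4, h5⟩
    have h3' := h1.2 h3
    rw [← (h2 h3').1] at h4
    rw [← (h2 h3').2] at h5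
    exact ⟨h3', h4, h5⟩

theorem threshold_congr (t : ℕ) (h : ∀ j, ∀ r ≤ t, z j r = z' j r) :
    threshold ℓ z t = threshold ℓ z' t := by
  induction t using Nat.strong_induction_on with
  | _ t ih =>
    have ha : ∀ k < t, threshold ℓ z k = threshold ℓ z' k :=
      fun k hk => ih k hk fun j r hr => h j r (hr.trans hk.le)
    have ho : ∀ k ≤ t, ∀ j, offer (threshold ℓ z) z k j = offer (threshold ℓ z') z' k j := by
      intro k hk j
      rw [offer_congr z (b := threshold ℓ z') (fun l hl => ha l (hl.trans_le hk))]
      exact h j _ ((used_le _ _ _).trans hk)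
    funext i
    have hl := roundLoad_congr_of_agree (z := z) (z' := z') (a := threshold ℓ z)
      (a' := threshold ℓ z') (t := t) (fun k hk j => by
        have hr : ∀ i, rejects (threshold ℓ z) k i = rejects (threshold ℓ z') k i :=
          rejects_congr (ha k hk)
        simp only [reaches, hr, ho k hk.le j, and_self, implies_true])
    rw [threshold_eq, threshold_eq, ho t le_rfl, hl]

/-- The number of elements of the pool of round `j` that are used up to the moment when the ball
`t` has been offered its allocation in round `i`. -/
noncomputable def usedAt (a : ℕ → Fin (d - 1) → Bool) (t : ℕ) (i j : Fin d) : ℕ :=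
  used a (if j ≤ i then t + 1 else t) j

/-- The process run by the threshold strategy up to some moment is determined by the elements of the
pools that have been used. -/
theorem threshold_agree (t : ℕ) (i : Fin d)
    (h : ∀ j, ∀ r < usedAt (threshold ℓ z) t i j, z j r = z' j r) (s : ℕ) :
    ∀ j : Fin d, (s < t ∨ s = t ∧ j ≤ i) →
      (reaches (threshold ℓ z) s j ↔ reaches (threshold ℓ z') s j) ∧
      (reaches (threshold ℓ z) s j →
        offer (threshold ℓ z) z s j = offer (threshold ℓ z') z' s j ∧
        rejects (threshold ℓ z) s j = rejects (threshold ℓ z') s j) := by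
  classical
  induction s using Nat.strong_induction_on with
  | _ s ih =>
    -- Agreement on the decisions follows from the agreement on who reaches the round.
    have step : ∀ j : Fin d, (s < t ∨ s = t ∧ j ≤ i) →
        (reaches (threshold ℓ z) s j ↔ reaches (threshold ℓ z') s j) →
        (reaches (threshold ℓ z) s j ↔ reaches (threshold ℓ z') s j) ∧
        (reaches (threshold ℓ z) s j →
          offer (threshold ℓ z) z s j = offer (threshold ℓ z') z' s j ∧
          rejects (threshold ℓ z) s j = rejects (threshold ℓ z') s j) := by
      intro j hs hiff
      refine ⟨hiff, fun hreach => ?_⟩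
      have IH : ∀ k < s, ∀ j : Fin d, _ := fun k hk j => ih k hk j (by omega)
      have hused : used (threshold ℓ z) s j = used (threshold ℓ z') s j := by
        unfold used
        congr 1
        exact Finset.filter_congr fun k hk => (IH k (Finset.mem_range.1 hk) j).1
      have hlt : used (threshold ℓ z) s j < usedAt (threshold ℓ z) t i j := by
        refine used_lt_used _ hreach ?_
        rcases hs with hs | ⟨rfl, hs⟩
        · split_ifs <;> omega
        · rw [if_pos hs]; omega
      have hoffer : offer (threshold ℓ z) z s j = offer (threshold ℓ z') z' s j := by
        unfold offer
        rw [h j _ hlt, hused]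
      refine ⟨hoffer, ?_⟩
      by_cases hj : (j : ℕ) < d - 1
      · rw [Bool.eq_iff_iff, rejects_threshold z s j hj, rejects_threshold z' s j hj, hoffer,
          roundLoad_congr_of_agree IH]
      · rw [rejects_of_le _ (not_lt.1 hj), rejects_of_le _ (not_lt.1 hj)]
    rintro ⟨j, hj⟩
    induction j with
    | zero => exact fun hs => step _ hs (by simp [reaches_zero])
    | succ j ihj =>
      intro hs
      have hs' : s < t ∨ s = t ∧ (⟨j, by omega⟩ : Fin d) ≤ i := by
        rcases hs with hs | ⟨hs, hj⟩
        · exact Or.inl hs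
        · exact Or.inr ⟨hs, le_trans (Nat.le_succ j) hj⟩
      obtain ⟨h1, h2⟩ := ihj (by omega) hs'
      refine step _ hs ?_
      simp only [reaches_succ]
      constructor
      · rintro ⟨h3, h4⟩
        exact ⟨h1.1 h3, (h2 h3).2 ▸ h4⟩
      · rintro ⟨h3, h4⟩
        have h3' := h1.2 h3
        exact ⟨h3', (h2 h3').2.symm ▸ h4⟩

theorem usedAt_threshold_congr (t : ℕ) (i : Fin d)
    (h : ∀ j, ∀ r < usedAt (threshold ℓ z) t i j, z j r = z' j r) (j : Fin d) :
    usedAt (threshold ℓ z) t i j = usedAt (threshold ℓ z') t i j := by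
  classical
  unfold usedAt used
  congr 1
  refine Finset.filter_congr fun k hk => (threshold_agree t i h k j ?_).1
  rw [Finset.mem_range] at hk
  split_ifs at hk <;> omega

theorem history_threshold_congr {Ω : Type*} {Z : Fin d → ℕ → Ω → Fin n} {t : ℕ} {i : Fin d}
    {ω ω' : Ω}
    (h : ∀ j, ∀ r < usedAt (threshold ℓ fun l r => Z l r ω) t i j, Z j r ω = Z j r ω') :
    history Z (thresholdStrategy ℓ Z) t i ω = history Z (thresholdStrategy ℓ Z) t i ω' := by
  funext s j m b
  have key := threshold_agree (ℓ := ℓ) (z := fun l r => Z l r ω)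
    (z' := fun l r => Z l r ω') t i h s j
  unfold history thresholdStrategy
  refine propext (and_congr_right fun hs => ?_)
  obtain ⟨h1, h2⟩ := key hs
  constructor
  · rintro ⟨h3, h4, h5⟩
    exact ⟨h1.1 h3, (h2 h3).1 ▸ h4, (h2 h3).2 ▸ h5⟩
  · rintro ⟨h3, h4, h5⟩
    have h3' := h1.2 h3
    exact ⟨h3', (h2 h3').1.symm ▸ h4, (h2 h3').2.symm ▸ h5⟩

end ThresholdLocality

section ThresholdIsStrategy

variable {Ω : Type*} [MeasurableSpace Ω] {P : Measure Ω} {d n : ℕ} [NeZero d]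
  {Z : Fin d → ℕ → Ω → Fin n} {ℓ : ℝ}

theorem IsPool.measurable_threshold (hZ : IsPool P Z) (t : ℕ) (i : Fin (d - 1)) :
    Measurable (thresholdStrategy ℓ Z t i) := by
  rcases Nat.eq_zero_or_pos n with rfl | hn
  · have : IsEmpty Ω := ⟨fun ω => (Z (toRound i) 0 ω).elim0⟩
    exact measurable_of_empty _
  let φ : (Fin d → Fin (t + 1) → Fin n) → Bool := fun y =>
    threshold ℓ (fun j r => if h : r < t + 1 then y j ⟨r, h⟩ else ⟨0, hn⟩) t i
  have hφ : thresholdStrategy ℓ Z t i = φ ∘ fun ω j r => Z j r ω := by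
    funext ω
    simp only [thresholdStrategy, φ, Function.comp]
    rw [threshold_congr t fun j r hr => ?_]
    rw [dif_pos (Nat.lt_succ_of_le hr)]
  rw [hφ]
  exact (measurable_of_countable φ).comp
    (measurable_pi_lambda _ fun j => measurable_pi_lambda _ fun r => hZ.measurable j r)

theorem IsPool.isStrategy_threshold [IsProbabilityMeasure P] (hZ : IsPool P Z) (ℓ : ℝ) :
    IsStrategy P Z (thresholdStrategy ℓ Z) := by
  refine ⟨fun t i => hZ.measurable_threshold t i, fun t i => ?_⟩
  set H := history Z (thresholdStrategy ℓ Z) t i with hH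
  set F := future Z (thresholdStrategy ℓ Z) t i with hF
  let V : Ω → Fin d → ℕ := fun ω => usedAt (threshold ℓ fun l r => Z l r ω) t i
  let G : (Fin d → ℕ) → Ω → Fin d → ℕ → Fin n := fun v ω j r => Z j (v j + r) ω
  let ν := P.map fun ω j r => Z j r ω
  have hG : ∀ v, Measurable (G v) := fun v =>
    measurable_pi_lambda _ fun j => measurable_pi_lambda _ fun r => hZ.measurable j _
  -- The used part of the pools has finite shape `v`; what happened so far is an event about this
  -- part, and the future is a function of the remaining elements.
  let σ : Fin d × ℕ → MeasurableSpace Ω := fun p => MeasurableSpace.comap (Z p.1 p.2) inferInstance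
  have hσ : ∀ p, σ p ≤ ‹MeasurableSpace Ω› := fun p => (hZ.measurable p.1 p.2).comap_le
  let S : (Fin d → ℕ) → Set (Fin d × ℕ) := fun v => {p | p.2 < v p.1}
  have hle : ∀ T : Set (Fin d × ℕ), ⨆ p ∈ T, σ p ≤ ‹MeasurableSpace Ω› := fun T =>
    iSup₂_le fun p _ => hσ p
  have hpast : ∀ (v : Fin d → ℕ) (A : Set (ℕ → Fin d → Fin n → Bool → Prop)),
      MeasurableSet[⨆ p ∈ S v, σ p] (H ⁻¹' A ∩ V ⁻¹' {v}) := by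
    intro v A
    let R : Ω → (∀ j, Fin (v j) → Fin n) := fun ω j r => Z j r ω
    have hR : Measurable[⨆ p ∈ S v, σ p] R := by
      refine @measurable_pi_lambda _ _ _ (_) _ _ fun j =>
        @measurable_pi_lambda _ _ _ (_) _ _ fun r => ?_
      refine Measurable.mono (comap_measurable (Z j r)) ?_ le_rfl
      exact le_iSup₂_of_le (f := fun p (_ : p ∈ S v) => σ p) (j, (r : ℕ)) r.2 le_rfl
    have hE : H ⁻¹' A ∩ V ⁻¹' {v} = R ⁻¹' (R '' (H ⁻¹' A ∩ V ⁻¹' {v})) := by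
      refine Set.Subset.antisymm (Set.subset_preimage_image _ _) ?_
      rintro ω ⟨ω', ⟨h1, h2⟩, h3⟩
      have h2' : usedAt (threshold ℓ fun l r => Z l r ω') t i = v := h2
      have h4 : ∀ j, ∀ r < usedAt (threshold ℓ fun l r => Z l r ω') t i j,
          Z j r ω' = Z j r ω := by
        intro j r hr
        rw [h2'] at hr
        exact congrFun (congrFun h3 j) ⟨r, hr⟩
      refine ⟨?_, ?_⟩
      · have := history_threshold_congr (Z := Z) h4
        rw [Set.mem_preimage] at h1 ⊢
        rwa [hH, ← this]
      · exact (funext fun j => (usedAt_threshold_congr (ℓ := ℓ)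
          (z := fun l r => Z l r ω') (z' := fun l r => Z l r ω) t i h4 j)).symm.trans h2'
    rw [hE]
    exact hR (Set.toFinite _).measurableSet
  have hfut : ∀ v, Measurable[⨆ p ∈ (S v)ᶜ, σ p] (G v) := by
    intro v
    refine @measurable_pi_lambda _ _ _ (_) _ _ fun j =>
      @measurable_pi_lambda _ _ _ (_) _ _ fun r => ?_
    refine Measurable.mono (comap_measurable (Z j (v j + r))) ?_ le_rfl
    exact le_iSup₂_of_le (f := fun p (_ : p ∈ (S v)ᶜ) => σ p) (j, v j + r)
      (by simp [S]) le_rfl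
  have hFG : ∀ v, ∀ ω ∈ V ⁻¹' {v}, F ω = G v ω := by
    rintro v ω rfl
    rfl
  have hmain : ∀ A B, MeasurableSet B → P (H ⁻¹' A ∩ F ⁻¹' B) = P (H ⁻¹' A) * ν B := by
    intro A B hB
    have hcov : ∀ E : Set Ω, E = ⋃ v, E ∩ V ⁻¹' {v} := fun E => by
      ext ω; simp
    have hdisj : ∀ E : Set Ω, Pairwise (Function.onFun Disjoint fun v => E ∩ V ⁻¹' {v}) := by
      intro E v w hvw
      rw [Function.onFun, Set.disjoint_left]
      rintro ω ⟨_, h1⟩ ⟨_, h2⟩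
      exact hvw (h1.symm.trans h2)
    have h1 : ∀ v, H ⁻¹' A ∩ F ⁻¹' B ∩ V ⁻¹' {v} = (H ⁻¹' A ∩ V ⁻¹' {v}) ∩ G v ⁻¹' B := by
      intro v
      ext ω
      simp only [Set.mem_inter_iff, Set.mem_preimage]
      constructor
      · rintro ⟨⟨h1, h2⟩, h3⟩
        exact ⟨⟨h1, h3⟩, hFG v ω h3 ▸ h2⟩
      · rintro ⟨⟨h1, h3⟩, h2⟩
        exact ⟨⟨h1, (hFG v ω h3).symm ▸ h2⟩, h3⟩
    have h2 : ∀ v, P (H ⁻¹' A ∩ F ⁻¹' B ∩ V ⁻¹' {v}) = P (H ⁻¹' A ∩ V ⁻¹' {v}) * ν B := by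
      intro v
      have hind := indep_iSup_of_disjoint hσ hZ.indep.iIndep (S := S v) (T := (S v)ᶜ)
        disjoint_compl_right
      rw [h1 v, (Indep_iff _ _ _).1 hind _ _ (hpast v A) (hfut v hB)]
      congr 1
      rw [← Measure.map_apply (hG v) hB]
      exact congrArg (fun μ : Measure _ => μ B) (hZ.map_shift v)
    rw [hcov (H ⁻¹' A ∩ F ⁻¹' B), measure_iUnion (hdisj _) fun v => ?_, tsum_congr h2,
      ENNReal.tsum_mul_right, ← measure_iUnion (hdisj _) fun v => hle _ _ (hpast v A), ← hcov]
    rw [h1 v]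
    exact (hle _ _ (hpast v A)).inter (hG v hB)
  rw [indepFun_iff_measure_inter_preimage_eq_mul]
  intro A B _ hB
  have h := hmain Set.univ B hB
  rw [Set.preimage_univ, Set.univ_inter, measure_univ, one_mul] at h
  rw [hmain A B hB, h]

end ThresholdIsStrategy

/-! ### The future allocations of a strategy -/

section Future

variable {Ω : Type*} [MeasurableSpace Ω] {P : Measure Ω} {d n : ℕ}
  {Z : Fin d → ℕ → Ω → Fin n} {g : ℕ → Fin (d - 1) → Ω → Bool}

theorem IsStrategy.measurableSet_rejects (hg : IsStrategy P Z g) (t i : ℕ) (b : Bool) :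
    MeasurableSet {ω | rejects (fun k l => g k l ω) t i = b} := by
  by_cases h : i < d - 1
  · simp only [rejects, dif_pos h]
    exact hg.measurable t ⟨i, h⟩ (measurableSet_singleton b)
  · simp only [rejects, dif_neg h]
    exact MeasurableSet.const _

theorem IsStrategy.measurableSet_reaches (hg : IsStrategy P Z g) (t i : ℕ) :
    MeasurableSet {ω | reaches (fun k l => g k l ω) t i} := by
  induction i with
  | zero => simp [reaches_zero]
  | succ i ih =>
    simp only [reaches_succ]
    exact ih.inter (hg.measurableSet_rejects t i true)

theorem IsStrategy.measurable_used (hg : IsStrategy P Z g) (t i : ℕ) :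
    Measurable fun ω => used (fun k l => g k l ω) t i := by
  classical
  induction t with
  | zero => simp [used_zero]
  | succ t ih =>
    simp only [used_succ]
    exact ih.add (Measurable.ite (hg.measurableSet_reaches t i) measurable_const measurable_const)

theorem IsStrategy.measurable_pool_used_add (hg : IsStrategy P Z g) (hZ : IsPool P Z) (t : ℕ)
    (j : Fin d) (r : ℕ) : Measurable fun ω => Z j (used (fun k l => g k l ω) t j + r) ω := by
  have h1 : Measurable fun p : ℕ × Ω => Z j (p.1 + r) p.2 :=
    measurable_from_prod_countable_right fun k => hZ.measurable j (k + r)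
  exact h1.comp ((hg.measurable_used t j).prodMk measurable_id)

theorem IsStrategy.measurable_future (hg : IsStrategy P Z g) (hZ : IsPool P Z) (t : ℕ)
    (i : Fin d) : Measurable (future Z g t i) :=
  measurable_pi_lambda _ fun j => measurable_pi_lambda _ fun r =>
    hg.measurable_pool_used_add hZ _ j r

theorem IsStrategy.measurable_history (hg : IsStrategy P Z g) (hZ : IsPool P Z) (t : ℕ)
    (i : Fin d) : Measurable (history Z g t i) := by
  refine measurable_pi_lambda _ fun s => measurable_pi_lambda _ fun j => measurable_pi_lambda _
    fun m => measurable_pi_lambda _ fun b => measurableSet_setOfPred.1 ?_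
  refine (MeasurableSet.const _).inter ((hg.measurableSet_reaches s j).inter
    (MeasurableSet.inter ?_ (hg.measurableSet_rejects s j b)))
  exact hg.measurable_pool_used_add hZ s j 0 (measurableSet_singleton m)

variable [IsProbabilityMeasure P]

/-- One step of the process: whether a further element of a pool is used is decided by the history,
which is independent of the future, so the law of the future does not change. -/
theorem map_eq_of_shift_if (hZ : IsPool P Z) {α : Type*} [MeasurableSpace α] {H : Ω → α}
    {F F' : Ω → Fin d → ℕ → Fin n} (hF : Measurable F) (hF' : Measurable F')
    (hind : IndepFun H F P) (hlaw : P.map F = P.map fun ω j r => Z j r ω) {A : Set α}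
    (hH : Measurable H) (hA : MeasurableSet A) (v : Fin d → ℕ)
    (h1 : ∀ ω, H ω ∈ A → F' ω = fun j r => F ω j (v j + r)) (h2 : ∀ ω, H ω ∉ A → F' ω = F ω) :
    P.map F' = P.map fun ω j r => Z j r ω := by
  let σ : (Fin d → ℕ → Fin n) → Fin d → ℕ → Fin n := fun y j r => y j (v j + r)
  have hσ : Measurable σ := measurable_pi_lambda _ fun j => measurable_pi_lambda _ fun r =>
    (measurable_pi_apply (v j + r)).comp (measurable_pi_apply j)
  have hshift : P.map (σ ∘ F) = P.map fun ω j r => Z j r ω := by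
    rw [← Measure.map_map hσ hF, hlaw, Measure.map_map hσ hZ.measurable_pools]
    exact hZ.map_shift v
  ext B hB
  rw [Measure.map_apply hF' hB, ← measure_inter_add_sdiff (F' ⁻¹' B) (hH hA)]
  have e1 : F' ⁻¹' B ∩ H ⁻¹' A = H ⁻¹' A ∩ F ⁻¹' (σ ⁻¹' B) := by
    ext ω
    simp only [Set.mem_inter_iff, Set.mem_preimage]
    constructor
    · rintro ⟨h3, h4⟩
      rw [h1 ω h4] at h3
      exact ⟨h4, h3⟩
    · rintro ⟨h4, h3⟩
      refine ⟨?_, h4⟩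
      rw [h1 ω h4]
      exact h3
  have e2 : F' ⁻¹' B \ H ⁻¹' A = H ⁻¹' Aᶜ ∩ F ⁻¹' B := by
    ext ω
    simp only [Set.mem_inter_iff, Set.mem_preimage, Set.mem_sdiff, Set.mem_compl_iff]
    constructor
    · rintro ⟨h3, h4⟩
      exact ⟨h4, h2 ω h4 ▸ h3⟩
    · rintro ⟨h4, h3⟩
      exact ⟨(h2 ω h4).symm ▸ h3, h4⟩
  have e3 := indepFun_iff_measure_inter_preimage_eq_mul.1 hind
  rw [e1, e2, e3 _ _ hA (hσ hB), e3 _ _ hA.compl hB, ← Set.preimage_comp,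
    ← Measure.map_apply (hσ.comp hF) hB, ← Measure.map_apply hF hB, hshift, hlaw, ← add_mul,
    Set.preimage_compl, measure_add_measure_compl (hH hA), measure_univ, one_mul]

/-- At each moment the future allocations have the law of the pools. -/
theorem IsStrategy.map_future [NeZero d] (hg : IsStrategy P Z g) (hZ : IsPool P Z) (t : ℕ) :
    ∀ i : Fin d, P.map (future Z g t i) = P.map fun ω j r => Z j r ω := by
  classical
  have hd := NeZero.pos d
  let v : Fin d → Fin d → ℕ := fun i j => if j = i then 1 else 0
  -- Passing from one round to the next one for the same ball.
  have hround : ∀ t (i : ℕ) (hi : i + 1 < d),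
      P.map (future Z g t ⟨i, by omega⟩) = P.map (fun ω j r => Z j r ω) →
      P.map (future Z g t ⟨i + 1, hi⟩) = P.map fun ω j r => Z j r ω := by
    intro t i hi hlaw
    have hA : MeasurableSet {H : ℕ → Fin d → Fin n → Bool → Prop |
        ∃ m, H t ⟨i, by omega⟩ m true} := by
      refine measurableSet_setOfPred.2 (Measurable.exists fun m => ?_)
      fun_prop
    have hmem : ∀ ω, history Z g t ⟨i, by omega⟩ ω ∈ {H : ℕ → Fin d → Fin n → Bool → Prop |
        ∃ m, H t ⟨i, by omega⟩ m true} ↔ reaches (fun k l => g k l ω) t (i + 1) := by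
      intro ω
      simp only [Set.mem_ofPred_eq, history, reaches_succ]
      constructor
      · rintro ⟨m, _, h1, _, h2⟩
        exact ⟨h1, h2⟩
      · rintro ⟨h1, h2⟩
        exact ⟨_, Or.inr ⟨trivial, le_rfl⟩, h1, rfl, h2⟩
    refine map_eq_of_shift_if hZ (hg.measurable_future hZ t ⟨i, by omega⟩)
      (hg.measurable_future hZ t _) (hg.indep_future t ⟨i, by omega⟩) hlaw
      (hg.measurable_history hZ t _) hA (v ⟨i + 1, hi⟩) ?_ ?_
    · intro ω hω
      rw [hmem] at hω
      funext j r
      simp only [future, v, Fin.le_def, Fin.ext_iff]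
      rcases lt_trichotomy (j : ℕ) (i + 1) with h | h | h
      · rw [if_pos h.le, if_pos (by omega), if_neg h.ne, zero_add]
      · rw [if_pos h.le, if_neg (by omega), if_pos h, h, used_succ, if_pos hω, add_assoc]
      · rw [if_neg (by omega), if_neg (by omega), if_neg h.ne', zero_add]
    · intro ω hω
      rw [hmem] at hω
      funext j r
      simp only [future, Fin.le_def]
      rcases lt_trichotomy (j : ℕ) (i + 1) with h | h | h
      · rw [if_pos h.le, if_pos (by omega)]
      · rw [if_pos h.le, if_neg (by omega), h, used_succ, if_neg hω, add_zero]
      · rw [if_neg (by omega), if_neg (by omega)]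
  have hall : ∀ t, P.map (future Z g t ⟨0, hd⟩) = P.map (fun ω j r => Z j r ω) →
      ∀ i : Fin d, P.map (future Z g t i) = P.map fun ω j r => Z j r ω := by
    rintro t h0 ⟨i, hi⟩
    induction i with
    | zero => exact h0
    | succ i ih => exact hround t i hi (ih (by omega))
  induction t with
  | zero =>
    refine hall 0 ?_
    rw [← hZ.map_shift (v ⟨0, hd⟩)]
    congr 1
    funext ω j r
    simp only [future, v, Fin.le_def, Fin.ext_iff]
    rcases Nat.eq_zero_or_pos (j : ℕ) with h | h
    · rw [if_pos h.le, if_pos h, h, used_round_zero, zero_add]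
    · rw [if_neg (by omega), if_neg h.ne', used_zero]
  | succ t ih =>
    refine hall (t + 1) ?_
    refine map_eq_of_shift_if hZ (hg.measurable_future hZ t ⟨d - 1, by omega⟩)
      (hg.measurable_future hZ _ _) (hg.indep_future t ⟨d - 1, by omega⟩)
      (ih _) (hg.measurable_history hZ t _) MeasurableSet.univ (v ⟨0, hd⟩) ?_
      (fun ω h => absurd (Set.mem_univ _) h)
    intro ω _
    funext j r
    simp only [future, v, Fin.le_def, Fin.ext_iff]
    rw [if_pos (show (j : ℕ) ≤ d - 1 by omega)]
    rcases Nat.eq_zero_or_pos (j : ℕ) with h | h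
    · rw [if_pos h.le, if_pos h, h, used_round_zero, used_round_zero, add_assoc]
    · rw [if_neg (by omega), if_neg h.ne', zero_add]

theorem measure_mem_le_of_indepFun {β γ : Type*} [MeasurableSpace β] [MeasurableSpace γ]
    [Countable β] [MeasurableSingletonClass β] {K : Ω → β} {F : Ω → γ} (hK : Measurable K)
    (hind : IndepFun K F P) {B : β → Set γ} (hB : ∀ x, MeasurableSet (B x)) {δ : ENNReal}
    (hδ : ∀ x, P (F ⁻¹' B x) ≤ δ) : P {ω | F ω ∈ B (K ω)} ≤ δ := by
  have h1 : {ω | F ω ∈ B (K ω)} = ⋃ x, K ⁻¹' {x} ∩ F ⁻¹' B x := by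
    ext ω; simp
  rw [h1]
  refine (measure_iUnion_le _).trans ?_
  calc ∑' x, P (K ⁻¹' {x} ∩ F ⁻¹' B x) = ∑' x, P (K ⁻¹' {x}) * P (F ⁻¹' B x) :=
        tsum_congr fun x => indepFun_iff_measure_inter_preimage_eq_mul.1 hind _ _
          (measurableSet_singleton x) (hB x)
    _ ≤ ∑' x, P (K ⁻¹' {x}) * δ := ENNReal.tsum_le_tsum fun x => by gcongr; exact hδ x
    _ = P (⋃ x, K ⁻¹' {x}) * δ := by
        rw [ENNReal.tsum_mul_right, measure_iUnion _ fun x => hK (measurableSet_singleton x)]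
        intro x y hxy
        rw [Function.onFun, Set.disjoint_left]
        rintro ω h2 h3
        exact hxy (h2.symm.trans h3)
    _ ≤ δ := by
        refine (mul_le_mul_left prob_le_one δ).trans (one_mul δ).le

/-- The bins of load at least `s` after `t` balls. -/
noncomputable def heavyBins [NeZero d] (a : ℕ → Fin (d - 1) → Bool) (z : Fin d → ℕ → Fin n)
    (s t : ℕ) : Finset (Fin n) :=
  Finset.univ.filter fun m => s ≤ load a z m t

theorem mem_heavyBins [NeZero d] {a : ℕ → Fin (d - 1) → Bool} {z : Fin d → ℕ → Fin n} {s t : ℕ}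
    {m : Fin n} : m ∈ heavyBins a z s t ↔ s ≤ load a z m t := by simp [heavyBins]

/-- The bins of `heavyBins a z s t` that are hit in every one of `h` blocks of length `b` of the
part of the pool of round `i` that is unused after `t` balls. -/
noncomputable def hitHeavyBins [NeZero d] (a : ℕ → Fin (d - 1) → Bool) (z : Fin d → ℕ → Fin n)
    (s t : ℕ) (i : Fin d) (h b : ℕ) : Finset (Fin n) :=
  (heavyBins a z s t).filter fun m => Hits (blocks h b fun r => z i (used a t i + r)) m

/-- If there are at least `N` bins of load at least `s` after `t` balls, and `N p ^ h ≥ 4 Y` with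
`p` the probability that a bin occurs in a block, then it is unlikely that less than `2 Y` of
them are hit in every block. -/
theorem IsStrategy.measure_few_hits_le [NeZero d] (hg : IsStrategy P Z g) (hZ : IsPool P Z)
    (hn : 0 < n) {t : ℕ} (ht : 0 < t) (s : ℕ) (i : Fin d) (h b : ℕ) {N Y : ℝ} (hY : 0 < Y)
    (hN : 4 * Y ≤ N * hitProb n b ^ h) :
    P {ω | N ≤ ((heavyBins (fun k l => g k l ω) (fun l r => Z l r ω) s t).card : ℝ) ∧
        ((hitHeavyBins (fun k l => g k l ω) (fun l r => Z l r ω) s t i h b).card : ℝ) < 2 * Y} ≤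
      ENNReal.ofReal (1 / Y) := by
  classical
  obtain ⟨t, rfl⟩ : ∃ k, t = k + 1 := ⟨t - 1, by omega⟩
  have hd := NeZero.pos d
  set l : Fin d := ⟨d - 1, by omega⟩ with hl
  let L : (ℕ → Fin d → Fin n → Bool → Prop) → Fin n → ℕ := fun H m =>
    ((Finset.range (t + 1)).filter fun k => ∃ j, H k j m false).card
  have hL : Measurable L := by
    refine measurable_pi_lambda _ fun m => ?_
    simp only [L, Finset.card_filter]
    refine Finset.measurable_fun_sum _ fun k _ => ?_
    refine Measurable.ite ?_ measurable_const measurable_const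
    refine measurableSet_setOfPred.2 (Measurable.exists fun m => ?_)
    fun_prop
  let K : Ω → Fin n → ℕ := L ∘ history Z g t l
  have hK : Measurable K := hL.comp (hg.measurable_history hZ t l)
  have hKload : ∀ ω m, K ω m = load (fun k l => g k l ω) (fun l r => Z l r ω) m (t + 1) := by
    intro ω m
    simp only [K, L, Function.comp, load]
    congr 1
    refine Finset.filter_congr fun k hk => ?_
    rw [finalBin_eq_iff]
    refine exists_congr fun j => ?_
    have hk' := Finset.mem_range.1 hk
    have : k < t ∨ k = t ∧ j ≤ l := by
      rcases Nat.lt_succ_iff_lt_or_eq.1 hk' with h | h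
      · exact Or.inl h
      · exact Or.inr ⟨h, by rw [hl, Fin.le_def]; simp only; omega⟩
    simp only [history, this, true_and]
  have hind : IndepFun K (future Z g t l) P := by
    have := (hg.indep_future t l).comp hL measurable_id
    simpa using this
  let A : (Fin n → ℕ) → Finset (Fin n) := fun x => Finset.univ.filter fun m => s ≤ x m
  let B : (Fin n → ℕ) → Set (Fin d → ℕ → Fin n) := fun x =>
    {y | N ≤ ((A x).card : ℝ) ∧
      (((A x).filter fun m => Hits (blocks h b (y i)) m).card : ℝ) < 2 * Y}
  have hB : ∀ x, MeasurableSet (B x) := by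
    intro x
    have h1 : Measurable fun y : Fin d → ℕ → Fin n => blocks h b (y i) := by
      refine measurable_pi_lambda _ fun c => measurable_pi_lambda _ fun r => ?_
      exact (measurable_pi_apply _).comp (measurable_pi_apply i)
    exact (MeasurableSet.const _).inter (h1 (Set.toFinite {v |
      (((A x).filter fun m => Hits v m).card : ℝ) < 2 * Y}).measurableSet)
  have hδ : ∀ x, P (future Z g t l ⁻¹' B x) ≤ ENNReal.ofReal (1 / Y) := by
    intro x
    rw [← Measure.map_apply (hg.measurable_future hZ t l) (hB x), hg.map_future hZ,
      Measure.map_apply hZ.measurable_pools (hB x)]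
    by_cases hx : N ≤ ((A x).card : ℝ)
    · have hp : 0 ≤ hitProb n b ^ h := pow_nonneg (hitProb_nonneg hn b) h
      have h4 : 4 * Y ≤ (A x).card * hitProb n b ^ h :=
        hN.trans (mul_le_mul_of_nonneg_right hx hp)
      have hpos : 0 < (A x).card * hitProb n b ^ h := by linarith
      refine (measure_mono ?_).trans
        ((hZ.measure_few_hits_le hn i h b (A x) rfl hpos).trans (ENNReal.ofReal_le_ofReal ?_))
      · rintro ω ⟨_, h5⟩
        have h5' : (((A x).filter fun m => Hits (blocks h b fun r => Z i r ω) m).card : ℝ) <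
            2 * Y := h5
        rw [Set.mem_ofPred_eq]
        linarith
      · rw [div_le_div_iff₀ hpos hY]; linarith
    · have : (fun ω j r => Z j r ω) ⁻¹' B x = ∅ := by
        ext ω
        simp only [B, Set.mem_preimage, Set.mem_ofPred_eq, Set.mem_empty_iff_false, iff_false]
        exact fun h => hx h.1
      rw [this, measure_empty]
      exact zero_le
  refine le_trans (measure_mono ?_) (measure_mem_le_of_indepFun hK hind hB hδ)
  rintro ω hω
  have hA : A (K ω) = heavyBins (fun k l => g k l ω) (fun l r => Z l r ω) s (t + 1) := by
    ext m
    simp only [A, Finset.mem_filter, Finset.mem_univ, true_and, mem_heavyBins, hKload]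
  have hfut : future Z g t l ω i =
      fun r => Z i (used (fun k l => g k l ω) (t + 1) i + r) ω := by
    funext r
    simp only [future]
    rw [if_pos (by rw [hl, Fin.le_def]; simp only; omega)]
  simp only [B, Set.mem_ofPred_eq, hA, hfut]
  exact hω

end Future

/-! ### One stage of the lower bound -/

section Stage

variable {d n : ℕ} [NeZero d] {a : ℕ → Fin (d - 1) → Bool} {z : Fin d → ℕ → Fin n}

theorem heavyBins_mono {s t t' : ℕ} (h : t ≤ t') : heavyBins a z s t ⊆ heavyBins a z s t' :=
  fun m hm => mem_heavyBins.2 ((mem_heavyBins.1 hm).trans (load_mono a z m h))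

/-- A bin that occurs in every block is offered at least `h` times. -/
theorem le_card_of_hits {h b : ℕ} {y : ℕ → Fin n} {m : Fin n} (hm : Hits (blocks h b y) m) :
    h ≤ ((Finset.range (h * b)).filter fun r => y r = m).card := by
  choose r hr using hm
  have : (Finset.univ : Finset (Fin h)).card ≤
      ((Finset.range (h * b)).filter fun r => y r = m).card := by
    refine Finset.card_le_card_of_injOn (fun c => (c : ℕ) * b + r c) (fun c _ => ?_) ?_
    · refine Finset.mem_coe.2 (Finset.mem_filter.2 ⟨Finset.mem_range.2 ?_, hr c⟩)
      calc (c : ℕ) * b + r c < (c : ℕ) * b + b := by have := (r c).2; omega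
        _ = (c + 1) * b := by ring
        _ ≤ h * b := Nat.mul_le_mul_right b c.2
    · intro c _ c' _ hc
      exact (Prod.mk.inj (injective_block_index h b (a₁ := (c, r c)) (a₂ := (c', r c')) hc)).1
  rwa [Finset.card_univ, Fintype.card_fin] at this

theorem load_add_card_Ico {t t' : ℕ} (htt : t ≤ t') (m : Fin n) :
    load a z m t' = load a z m t +
      ((Finset.Ico t t').filter fun k => finalBin a z k = m).card := by
  unfold load
  rw [← Finset.card_union_of_disjoint, ← Finset.filter_union, Finset.range_eq_Ico,
    Finset.range_eq_Ico, Finset.Ico_union_Ico_eq_Ico (Nat.zero_le t) htt]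
  refine Finset.disjoint_filter_filter ?_
  rw [Finset.range_eq_Ico]
  exact Finset.Ico_disjoint_Ico_consecutive 0 t t'

/-- During a time interval, a heavy bin that is offered `h` times in round `i` either gains `h`
balls or is rejected there at least once; the rejected balls reach round `i + 1`. -/
theorem card_hitHeavyBins_le {t t' : ℕ} (htt : t ≤ t') (s : ℕ) (i : Fin d) {h b : ℕ}
    (hb : h * b ≤ used a t' i - used a t i) :
    (hitHeavyBins a z s t i h b).card ≤
      (heavyBins a z (s + h) t').card + (used a t' (i + 1) - used a t (i + 1)) := by
  classical
  have hcard := card_filter_reaches_Ico a (i + 1) (fun _ => True) htt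
  simp only [and_true, Finset.filter_true, Nat.card_Ico] at hcard
  rw [← hcard]
  have hsub : hitHeavyBins a z s t i h b ⊆ heavyBins a z (s + h) t' ∪
      ((Finset.Ico t t').filter fun k => reaches a k (i + 1)).image fun k => offer a z k i := by
    intro m hm
    obtain ⟨h1, h2⟩ := Finset.mem_filter.1 hm
    rw [Finset.mem_union, or_iff_not_imp_right, mem_heavyBins]
    intro h3
    have h4 : ∀ k ∈ Finset.Ico t t', reaches a k i → offer a z k i = m →
        rejects a k i = false := by
      intro k hk hk1 hk2
      by_contra hk3
      refine h3 (Finset.mem_image.2 ⟨k, Finset.mem_filter.2 ⟨hk, ?_⟩, hk2⟩)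
      exact (reaches_succ a k i).2 ⟨hk1, by simpa using hk3⟩
    rw [load_add_card_Ico htt]
    refine add_le_add (mem_heavyBins.1 h1) ?_
    calc h ≤ ((Finset.range (h * b)).filter fun r => z i (used a t i + r) = m).card :=
          le_card_of_hits h2
      _ ≤ ((Finset.Ico (used a t i) (used a t' i)).filter fun r => z i r = m).card := by
          refine Finset.card_le_card_of_injOn (fun r => used a t i + r) (fun r hr => ?_)
            fun r _ r' _ hr => Nat.add_left_cancel hr
          obtain ⟨hr1, hr2⟩ := Finset.mem_filter.1 hr
          rw [Finset.mem_range] at hr1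
          have h5 : used a t i + r < used a t' i := by omega
          exact Finset.mem_coe.2 (Finset.mem_filter.2
            ⟨Finset.mem_Ico.2 ⟨Nat.le_add_right _ _, h5⟩, hr2⟩)
      _ = ((Finset.Ico t t').filter fun k => reaches a k i ∧ z i (used a k i) = m).card := by
          convert (card_filter_reaches_Ico a i (fun r => z i r = m) htt).symm
      _ ≤ ((Finset.Ico t t').filter fun k => finalBin a z k = m).card := by
          refine Finset.card_le_card fun k hk => ?_
          obtain ⟨hk1, hk2, hk3⟩ := Finset.mem_filter.1 hk
          exact Finset.mem_filter.2 ⟨hk1, (finalBin_eq_iff a z k m).2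
            ⟨i, hk2, hk3, h4 k hk1 hk2 hk3⟩⟩
  exact (Finset.card_le_card hsub).trans ((Finset.card_union_le _ _).trans
    (Nat.add_le_add_left Finset.card_image_le _))

end Stage

/-! ### The staged growth of heavy bins -/

section Odometer

/-- The exponents `(A i, B i)` belonging to the increments `x`: with `x j` increments of size `h`
in each round `j < i` there are at least `n e ^ (-A i)` bins of load `h * ∑ j < i, x j`, and in a
stage where no further increment is possible in the rounds before `i`, of the order of
`n e ^ (-B i)` balls reach round `i`. An increment in round `i` costs the exponent
`h (B i + Λ)`. -/
noncomputable def exponents (h : ℕ) (Λ : ℝ) (x : ℕ → ℕ) : ℕ → ℝ × ℝ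
  | 0 => (0, 0)
  | i + 1 => ((exponents h Λ x i).1 + x i * h * ((exponents h Λ x i).2 + Λ),
      (exponents h Λ x i).1 + (x i + 1) * h * ((exponents h Λ x i).2 + Λ))

/-- The exponent of the number of bins of load `h * ∑ j < i, x j`. -/
noncomputable def binExp (h : ℕ) (Λ : ℝ) (x : ℕ → ℕ) (i : ℕ) : ℝ := (exponents h Λ x i).1

/-- The exponent of the number of balls that reach round `i`. -/
noncomputable def ballExp (h : ℕ) (Λ : ℝ) (x : ℕ → ℕ) (i : ℕ) : ℝ := (exponents h Λ x i).2

variable {h : ℕ} {Λ : ℝ} {x : ℕ → ℕ}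

theorem binExp_succ (i : ℕ) :
    binExp h Λ x (i + 1) = binExp h Λ x i + x i * h * (ballExp h Λ x i + Λ) := rfl

theorem ballExp_succ (i : ℕ) :
    ballExp h Λ x (i + 1) = binExp h Λ x i + (x i + 1) * h * (ballExp h Λ x i + Λ) := rfl

theorem exponents_congr {x' : ℕ → ℕ} {i : ℕ} (hx : ∀ j < i, x j = x' j) :
    exponents h Λ x i = exponents h Λ x' i := by
  induction i with
  | zero => rfl
  | succ i ih =>
    rw [exponents, exponents, ih fun j hj => hx j (by omega), hx i (by omega)]

theorem exponents_nonneg (hΛ : 0 ≤ Λ) (i : ℕ) : 0 ≤ binExp h Λ x i ∧ 0 ≤ ballExp h Λ x i := by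
  induction i with
  | zero => exact ⟨le_rfl, le_rfl⟩
  | succ i ih =>
    obtain ⟨h1, h2⟩ := ih
    rw [binExp_succ, ballExp_succ]
    constructor <;> positivity

theorem ballExp_succ' (i : ℕ) :
    ballExp h Λ x (i + 1) = binExp h Λ x (i + 1) + h * (ballExp h Λ x i + Λ) := by
  rw [ballExp_succ, binExp_succ]; ring

theorem ballExp_add_le_succ (hh : 0 < h) (hΛ : 0 ≤ Λ) (i : ℕ) :
    ballExp h Λ x i + Λ ≤ ballExp h Λ x (i + 1) := by
  rw [ballExp_succ']
  have h1 := (exponents_nonneg (h := h) (x := x) hΛ (i + 1)).1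
  have h2 := (exponents_nonneg (h := h) (x := x) hΛ i).2
  have h3 : (1 : ℝ) ≤ h := Nat.one_le_cast.2 hh
  nlinarith

theorem ballExp_mono (hh : 0 < h) (hΛ : 0 ≤ Λ) : Monotone (ballExp h Λ x) :=
  monotone_nat_of_le_succ fun i => by have := ballExp_add_le_succ (x := x) hh hΛ i; linarith

theorem ballExp_add_le_prod (hΛ : 0 ≤ Λ) (i : ℕ) :
    ballExp h Λ x i + Λ ≤ (∏ j ∈ Finset.range i, ((x j + 1) * h + 1 : ℝ)) * Λ := by
  have hle : ∀ i, binExp h Λ x i ≤ ballExp h Λ x i := by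
    rintro (_ | i)
    · exact le_rfl
    · rw [ballExp_succ']
      have h2 := (exponents_nonneg (h := h) (x := x) hΛ i).2
      have : 0 ≤ h * (ballExp h Λ x i + Λ) := by positivity
      linarith
  induction i with
  | zero => simp [ballExp, exponents]
  | succ i ih =>
    rw [Finset.prod_range_succ]
    have h1 := hle i
    have h2 : (0 : ℝ) ≤ (x i + 1) * h + 1 := by positivity
    rw [ballExp_succ]
    nlinarith

/-- The next state of the odometer: one more increment in round `i`, none in later rounds. -/
def tick (x : ℕ → ℕ) (i j : ℕ) : ℕ := if j < i then x j else if j = i then x i + 1 else 0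

theorem tick_of_lt {i j : ℕ} (hj : j < i) : tick x i j = x j := if_pos hj

theorem tick_self (i : ℕ) : tick x i i = x i + 1 := by simp [tick]

theorem tick_of_gt {i j : ℕ} (hj : i < j) : tick x i j = 0 := by
  rw [tick, if_neg (by omega), if_neg (by omega)]

theorem sum_tick_of_le {i k : ℕ} (hk : k ≤ i) :
    ∑ j ∈ Finset.range k, tick x i j = ∑ j ∈ Finset.range k, x j :=
  Finset.sum_congr rfl fun _ hj => tick_of_lt ((Finset.mem_range.1 hj).trans_le hk)

theorem sum_tick_of_gt {i k : ℕ} (hk : i < k) :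
    ∑ j ∈ Finset.range k, tick x i j = ∑ j ∈ Finset.range (i + 1), x j + 1 := by
  induction k, Nat.succ_le_of_lt hk using Nat.le_induction with
  | base =>
    rw [Finset.sum_range_succ, sum_tick_of_le le_rfl, tick_self, Finset.sum_range_succ, add_assoc]
  | succ k hk ih =>
    rw [Finset.sum_range_succ, ih (by omega), tick_of_gt (by omega), add_zero]

theorem binExp_tick_of_le {i k : ℕ} (hk : k ≤ i) :
    binExp h Λ (tick x i) k = binExp h Λ x k := by
  rw [binExp, binExp, exponents_congr fun j hj => tick_of_lt (hj.trans_le hk)]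

theorem binExp_tick_of_gt {i k : ℕ} (hk : i < k) :
    binExp h Λ (tick x i) k = ballExp h Λ x (i + 1) := by
  induction k, Nat.succ_le_of_lt hk using Nat.le_induction with
  | base =>
    rw [Nat.succ_eq_add_one, binExp_succ, ballExp_succ, binExp_tick_of_le le_rfl, tick_self,
      ballExp, exponents_congr fun j hj => tick_of_lt hj]
    push_cast
    rfl
  | succ k hk ih =>
    rw [binExp_succ, ih (by omega), tick_of_gt (by omega)]
    simp

/-- The number with the digits `x 0, …, x (k - 1)` in base `J + 1`. -/
def horner (J : ℕ) (x : ℕ → ℕ) : ℕ → ℕ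
  | 0 => 0
  | k + 1 => horner J x k * (J + 1) + x k

theorem horner_lt {J : ℕ} (hx : ∀ j, x j ≤ J) (k : ℕ) : horner J x k < (J + 1) ^ k := by
  induction k with
  | zero => simp [horner]
  | succ k ih =>
    have h1 := hx k
    rw [horner, pow_succ]
    calc horner J x k * (J + 1) + x k < horner J x k * (J + 1) + (J + 1) := by omega
      _ = (horner J x k + 1) * (J + 1) := by ring
      _ ≤ (J + 1) ^ k * (J + 1) := Nat.mul_le_mul_right _ ih

theorem horner_congr {J : ℕ} {x' : ℕ → ℕ} {k : ℕ} (hx : ∀ j < k, x j = x' j) :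
    horner J x k = horner J x' k := by
  induction k with
  | zero => rfl
  | succ k ih => rw [horner, horner, ih fun j hj => hx j (by omega), hx k (by omega)]

theorem horner_lt_horner_tick {J : ℕ} (hx : ∀ j, x j ≤ J) {i k : ℕ} (hk : i < k) :
    horner J x k < horner J (tick x i) k := by
  induction k, Nat.succ_le_of_lt hk using Nat.le_induction with
  | base =>
    rw [Nat.succ_eq_add_one, horner, horner, tick_self,
      horner_congr (x := tick x i) (x' := x) fun j hj => tick_of_lt hj]
    omega
  | succ k hk ih =>
    have h1 := ih (by omega)
    have h2 := hx k
    rw [horner, horner, tick_of_gt (by omega)]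
    nlinarith

/-- The states of the odometer for `d` rounds with less than `J` increments. -/
def states (d J : ℕ) : Set (ℕ → ℕ) := {x | (∀ j, d ≤ j → x j = 0) ∧ ∑ j ∈ Finset.range d, x j < J}

theorem le_of_mem_states {d J : ℕ} (hx : x ∈ states d J) (j : ℕ) : x j ≤ J := by
  rcases le_or_gt d j with h | h
  · rw [hx.1 j h]; exact Nat.zero_le _
  · exact (Finset.single_le_sum (f := x) (fun _ _ => Nat.zero_le _)
      (Finset.mem_range.2 h)).trans hx.2.le

theorem finite_states (d J : ℕ) : (states d J).Finite := by
  let f : (ℕ → ℕ) → Fin d → Fin (J + 1) := fun x j => Fin.ofNat (J + 1) (x j)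
  refine Set.Finite.of_finite_image (f := f) (Set.toFinite _) ?_
  intro x hx y hy hxy
  funext j
  rcases le_or_gt d j with h | h
  · rw [hx.1 j h, hy.1 j h]
  · have h1 := congrArg Fin.val (congrFun hxy ⟨j, h⟩)
    have h2 := le_of_mem_states hx j
    have h3 := le_of_mem_states hy j
    simp only [f, Fin.ofNat] at h1
    rwa [Nat.mod_eq_of_lt (by omega), Nat.mod_eq_of_lt (by omega)] at h1

variable {d n : ℕ} [NeZero d] {a : ℕ → Fin (d - 1) → Bool} {z : Fin d → ℕ → Fin n}

/-- The block length for round `i`: `h` blocks are filled if at least `c n e ^ (-B i)` balls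
reach round `i`. -/
noncomputable def blockLength (n h : ℕ) (Λ c : ℝ) (x : ℕ → ℕ) (i : ℕ) : ℕ :=
  ⌊c * n * Real.exp (-ballExp h Λ x i) / h⌋₊

/-- In a stage that starts after `t` balls, many of the heavy bins are hit in every block of
round `i`. -/
def ManyHits (a : ℕ → Fin (d - 1) → Bool) (z : Fin d → ℕ → Fin n) (h : ℕ) (Λ c : ℝ)
    (x : ℕ → ℕ) (t : ℕ) (i : Fin d) : Prop :=
  n * Real.exp (-binExp h Λ x (i + 1)) ≤
      ((heavyBins a z (h * ∑ j ∈ Finset.range (i + 1), x j) t).card : ℝ) →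
    2 * (n * Real.exp (-ballExp h Λ x (i + 1))) ≤
      ((hitHeavyBins a z (h * ∑ j ∈ Finset.range (i + 1), x j) t i h
        (blockLength n h Λ c x i)).card : ℝ)

/-- In each stage the number of increments can be raised in some round: otherwise, round by round,
the bins that are hit reject many balls, also in the last round, where this is impossible. -/
theorem exists_increment (hn : 0 < n) {c : ℝ} (hc : 0 < c) (hc1 : c ≤ 1) {t t' : ℕ}
    (htt : t ≤ t') (htime : c * n ≤ ((t' - t : ℕ) : ℝ))
    (hstate : ∀ k ≤ d, n * Real.exp (-binExp h Λ x k) ≤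
      ((heavyBins a z (h * ∑ j ∈ Finset.range k, x j) t).card : ℝ))
    (hgood : ∀ i : Fin d, ManyHits a z h Λ c x t i) :
    ∃ i : Fin d, n * Real.exp (-ballExp h Λ x (i + 1)) ≤
      ((heavyBins a z (h * (∑ j ∈ Finset.range (i + 1), x j + 1)) t').card : ℝ) := by
  by_contra! hcon
  have hn' : (0 : ℝ) < n := Nat.cast_pos.2 hn
  have key : ∀ i ≤ d, c * n * Real.exp (-ballExp h Λ x i) ≤
      ((used a t' i - used a t i : ℕ) : ℝ) := by
    intro i
    induction i with
    | zero =>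
      intro _
      rw [used_round_zero, used_round_zero]
      simpa [ballExp, exponents] using htime
    | succ i ih =>
      intro hi
      have ih' := ih (by omega)
      let i' : Fin d := ⟨i, by omega⟩
      have hb : h * blockLength n h Λ c x i ≤ used a t' i - used a t i := by
        rcases Nat.eq_zero_or_pos h with rfl | hh
        · simp
        have hh' : (0 : ℝ) < h := Nat.cast_pos.2 hh
        have h1 : (blockLength n h Λ c x i : ℝ) ≤ c * n * Real.exp (-ballExp h Λ x i) / h :=
          Nat.floor_le (by positivity)
        rw [le_div_iff₀ hh'] at h1
        have h2 : ((h * blockLength n h Λ c x i : ℕ) : ℝ) ≤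
            ((used a t' i - used a t i : ℕ) : ℝ) := by
          push_cast
          linarith
        exact_mod_cast h2
      have h3 := card_hitHeavyBins_le (z := z) htt (h * ∑ j ∈ Finset.range (i + 1), x j) i' hb
      have h4 := hgood i' (hstate (i + 1) hi)
      have h5 := hcon i'
      rw [mul_add, mul_one] at h5
      have h6 := (Nat.cast_le (α := ℝ)).2 h3
      push_cast at h6
      have h7 : n * Real.exp (-ballExp h Λ x (i + 1)) ≤
          ((used a t' (i + 1) - used a t (i + 1) : ℕ) : ℝ) := by
        simp only [i'] at h4 h5 h6
        linarith
      refine le_trans ?_ h7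
      have : 0 ≤ n * Real.exp (-ballExp h Λ x (i + 1)) := by positivity
      rw [mul_assoc]
      nlinarith
  have h8 := key d le_rfl
  have h9 : used a t' d = 0 := by
    classical
    unfold used
    rw [Finset.card_eq_zero, Finset.filter_eq_empty_iff]
    exact fun k _ => not_reaches_of_le a le_rfl
  rw [h9, Nat.zero_sub, Nat.cast_zero] at h8
  have : 0 < c * n * Real.exp (-ballExp h Λ x d) := by positivity
  linarith

/-- After `(J + 1) ^ d` stages the odometer has made `J` increments. -/
theorem exists_le_load (hn : 0 < n) {c : ℝ} (hc : 0 < c) (hc1 : c ≤ 1) {J : ℕ} (hJ : 0 < J)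
    {t : ℕ → ℕ} (ht : Monotone t) (htime : ∀ q, c * n ≤ ((t (q + 1) - t q : ℕ) : ℝ))
    (hgood : ∀ q < (J + 1) ^ d, ∀ x ∈ states d J, ∀ i, ManyHits a z h Λ c x (t q) i) :
    ∃ m, h * J ≤ load a z m (t ((J + 1) ^ d)) := by
  have hn' : (0 : ℝ) < n := Nat.cast_pos.2 hn
  have key : ∀ q ≤ (J + 1) ^ d, (∃ m, h * J ≤ load a z m (t q)) ∨
      ∃ x ∈ states d J, q ≤ horner J x d ∧ ∀ k ≤ d, n * Real.exp (-binExp h Λ x k) ≤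
        ((heavyBins a z (h * ∑ j ∈ Finset.range k, x j) (t q)).card : ℝ) := by
    intro q
    induction q with
    | zero =>
      intro _
      refine Or.inr ⟨fun _ => 0, ⟨fun _ _ => rfl, by simpa using hJ⟩, Nat.zero_le _, fun k _ => ?_⟩
      have h1 : binExp h Λ (fun _ => 0) k = 0 := by
        induction k with
        | zero => rfl
        | succ k ih => rw [binExp_succ, ih (by omega)]; simp
      have h2 : heavyBins a z (h * ∑ j ∈ Finset.range k, 0) (t 0) = Finset.univ := by
        ext m; simp [mem_heavyBins]
      rw [h1, h2, Finset.card_univ, Fintype.card_fin]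
      simp
    | succ q ih =>
      intro hq
      rcases ih (by omega) with ⟨m, hm⟩ | ⟨x, hx, hxq, hstate⟩
      · exact Or.inl ⟨m, hm.trans (load_mono a z m (ht (Nat.le_succ q)))⟩
      · obtain ⟨i, hi⟩ := exists_increment hn hc hc1 (ht (Nat.le_succ q)) (htime q) hstate
          (hgood q (by omega) x hx)
        have hstate' : ∀ k ≤ d, n * Real.exp (-binExp h Λ (tick x i) k) ≤
            ((heavyBins a z (h * ∑ j ∈ Finset.range k, tick x i j) (t (q + 1))).card : ℝ) := by
          intro k hk
          rcases le_or_gt k i with hki | hki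
          · rw [binExp_tick_of_le hki, sum_tick_of_le hki]
            exact (hstate k hk).trans (Nat.cast_le.2 (Finset.card_le_card
              (heavyBins_mono (ht (Nat.le_succ q)))))
          · rw [binExp_tick_of_gt hki, sum_tick_of_gt hki]
            exact hi
        rcases lt_or_ge (∑ j ∈ Finset.range d, tick x i j) J with hs | hs
        · refine Or.inr ⟨tick x i, ⟨fun j hj => tick_of_gt (i.2.trans_le hj), hs⟩, ?_, hstate'⟩
          have := horner_lt_horner_tick (le_of_mem_states hx) i.2
          omega
        · refine Or.inl ?_
          have h1 : (0 : ℝ) < ((heavyBins a z (h * ∑ j ∈ Finset.range d, tick x i j)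
              (t (q + 1))).card : ℝ) := lt_of_lt_of_le (by positivity) (hstate' d le_rfl)
          obtain ⟨m, hm⟩ := Finset.card_pos.1 (Nat.cast_pos.1 h1)
          exact ⟨m, (Nat.mul_le_mul_left h hs).trans (mem_heavyBins.1 hm)⟩
  rcases key _ le_rfl with h1 | ⟨x, hx, hxq, _⟩
  · exact h1
  · exact absurd (horner_lt (le_of_mem_states hx) d) (not_lt.2 hxq)

end Odometer

/-! ### The probability bounds for a fixed number of bins -/

section UpperBound

variable {Ω : Type*} [MeasurableSpace Ω] {P : Measure Ω} {d n : ℕ} [NeZero d]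
  {Z : Fin d → ℕ → Ω → Fin n}

/-- With high probability at most `n * reachFrac K ρ i` balls reach round `i`. The factor
`exp 2` in place of `exp 1` makes this bound larger than the mean by a factor `exp K`. -/
noncomputable def reachFrac (K : ℕ) (ρ : ℝ) : ℕ → ℝ
  | 0 => ρ
  | i + 1 => (Real.exp 2 * reachFrac K ρ i / K) ^ K

theorem reachFrac_pos {K : ℕ} (hK : 0 < K) {ρ : ℝ} (hρ : 0 < ρ) (i : ℕ) :
    0 < reachFrac K ρ i := by
  have hK' : (0 : ℝ) < K := Nat.cast_pos.2 hK
  induction i with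
  | zero => exact hρ
  | succ i ih => rw [reachFrac]; positivity

/-- The quantities `G i = log K - 2 - log (reachFrac K ρ i)` grow at least by the factor `K` in each
round. -/
theorem pow_mul_le_neg_log_reachFrac {K : ℕ} (hK : 0 < K) {ρ : ℝ} (hρ : 0 < ρ)
    (hlog : 2 ≤ Real.log K) (i : ℕ) :
    (K : ℝ) ^ i * (Real.log K - 2 - Real.log ρ) ≤
      Real.log K - 2 - Real.log (reachFrac K ρ i) := by
  have hK' : (0 : ℝ) < K := Nat.cast_pos.2 hK
  induction i with
  | zero => simp [reachFrac]
  | succ i ih =>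
    have hw := reachFrac_pos hK hρ i
    have h1 : Real.log (reachFrac K ρ (i + 1)) =
        K * (2 + Real.log (reachFrac K ρ i) - Real.log K) := by
      rw [reachFrac, Real.log_pow, Real.log_div (by positivity) hK'.ne',
        Real.log_mul (Real.exp_ne_zero 2) hw.ne', Real.log_exp]
    rw [h1, pow_succ]
    nlinarith

theorem IsPool.measure_lt_maxLoad_threshold_le (hZ : IsPool P Z) (hn : 0 < n) {ℓ ρ : ℝ}
    (hℓ : 0 ≤ ℓ) (hρ : 0 < ρ) {K : ℕ} (hK : K = ⌊ℓ⌋₊ + 2) {T : ℕ} (hT : T = ⌊ρ * n⌋₊) {S : ℕ}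
    (hS : 0 < S) :
    P {ω | (d - 1) * (⌊ℓ⌋₊ + 1) + (S - 1) < MaxLoad Z (thresholdStrategy ℓ Z) T ω} ≤
      d * ENNReal.ofReal (Real.exp (-K)) +
        ENNReal.ofReal (n * (Real.exp 1 * reachFrac K ρ (d - 1) / S) ^ S) := by
  have hn' : (0 : ℝ) < n := Nat.cast_pos.2 hn
  have hK0 : 0 < K := by omega
  have hK' : (0 : ℝ) < K := Nat.cast_pos.2 hK0
  have hd := NeZero.pos d
  set w := reachFrac K ρ with hw
  have hw0 : ∀ i, 0 < w i := reachFrac_pos hK0 hρ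
  let u : ℕ → ℕ := fun i => ⌊n * w i⌋₊
  have hu : ∀ i, (u i : ℝ) ≤ n * w i := fun i => Nat.floor_le (mul_pos hn' (hw0 i)).le
  let B : Fin d → Set Ω := fun i => {ω | (n : ℝ) * w (i + 1) ≤
    ((∑ m, (poolCount (fun l r => Z l r ω) i m (u i)).choose K : ℕ) : ℝ)}
  let C : Set Ω := {ω | (1 : ℝ) ≤ ((∑ m,
    (poolCount (fun l r => Z l r ω) ⟨d - 1, Nat.sub_lt hd one_pos⟩ m
    (u (d - 1))).choose S : ℕ) : ℝ)}
  have hB : ∀ i, P (B i) ≤ ENNReal.ofReal (Real.exp (-K)) := by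
    intro i
    refine (hZ.measure_le_sum_choose hn i hK0 (hu i) (mul_pos hn' (hw0 _))).trans
      (ENNReal.ofReal_le_ofReal (le_of_eq ?_))
    have h1 : w (i + 1) = Real.exp K * (Real.exp 1 * w i / K) ^ K := by
      rw [hw, reachFrac, ← mul_one (K : ℝ), Real.exp_nat_mul, ← mul_pow, mul_one]
      congr 1
      rw [show (2 : ℝ) = 1 + 1 by norm_num, Real.exp_add]
      ring
    have h2 : 0 < (Real.exp 1 * w i / K) ^ K := by have := hw0 i; positivity
    rw [h1, Real.exp_neg]
    field_simp
  have hC : P C ≤ ENNReal.ofReal (n * (Real.exp 1 * w (d - 1) / S) ^ S) := by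
    refine (hZ.measure_le_sum_choose hn _ hS (hu (d - 1)) one_pos).trans (le_of_eq ?_)
    rw [div_one]
  have hsub : {ω | (d - 1) * (⌊ℓ⌋₊ + 1) + (S - 1) < MaxLoad Z (thresholdStrategy ℓ Z) T ω} ⊆
      (⋃ i, B i) ∪ C := by
    intro ω hω
    by_contra hcon
    simp only [Set.mem_union, Set.mem_iUnion, not_or, not_exists] at hcon
    obtain ⟨h1, h2⟩ := hcon
    have hω' : (d - 1) * (⌊ℓ⌋₊ + 1) + (S - 1) < MaxLoad Z (thresholdStrategy ℓ Z) T ω := hω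
    refine absurd hω' (not_lt.2 ?_)
    refine maxLoad_threshold_le (fun l r => Z l r ω) hℓ T u ?_ (fun i hi => ?_) (S - 1)
      (fun i hi m => ?_)
    · rw [hT, mul_comm]; rfl
    · rw [← hK]
      exact Nat.le_floor (not_le.1 (h1 i)).le
    · have hi' : i = ⟨d - 1, Nat.sub_lt hd one_pos⟩ := Fin.ext hi
      by_contra h3
      refine h2 ?_
      have h4 : 1 ≤ (poolCount (fun l r => Z l r ω) i m (u i)).choose S :=
        Nat.choose_pos (by omega)
      rw [hi'] at h4
      have h5 := h4.trans (Finset.single_le_sum (f := fun m =>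
        (poolCount (fun l r => Z l r ω) ⟨d - 1, Nat.sub_lt hd one_pos⟩ m (u (d - 1))).choose S)
        (fun _ _ => Nat.zero_le _) (Finset.mem_univ m))
      exact (Nat.one_le_cast (α := ℝ)).2 h5
  refine (measure_mono hsub).trans ((measure_union_le _ _).trans (add_le_add ?_ hC))
  refine (measure_iUnion_fintype_le _ _).trans ((Finset.sum_le_sum fun i _ => hB i).trans ?_)
  rw [Finset.sum_const, Finset.card_univ, Fintype.card_fin, nsmul_eq_mul]

end UpperBound

section LowerBound

variable {Ω : Type*} [MeasurableSpace Ω] {P : Measure Ω} [IsProbabilityMeasure P] {d n : ℕ}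
  [NeZero d] {Z : Fin d → ℕ → Ω → Fin n} {g : ℕ → Fin (d - 1) → Ω → Bool}

theorem IsStrategy.measure_not_manyHits_le (hg : IsStrategy P Z g) (hZ : IsPool P Z) (hn : 0 < n)
    {h : ℕ} (hh : 0 < h) {c Λ : ℝ} (hc : 0 < c) (hc1 : c ≤ 1) (hΛ : Λ = Real.log (16 * h / c))
    {x : ℕ → ℕ} {η : ℝ} (hη : 0 ≤ η) (hx : ballExp h Λ x d ≤ (1 - η) * Real.log n) {t : ℕ}
    (ht : 0 < t) (i : Fin d) :
    P {ω | ¬ ManyHits (fun k l => g k l ω) (fun l r => Z l r ω) h Λ c x t i} ≤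
      ENNReal.ofReal (Real.exp (-(η * Real.log n))) := by
  have hn' : (0 : ℝ) < n := Nat.cast_pos.2 hn
  have hh1 : (1 : ℝ) ≤ h := Nat.one_le_cast.2 hh
  have hh' : (0 : ℝ) < h := by linarith
  have hΛ0 : 0 ≤ Λ := by
    rw [hΛ]
    refine Real.log_nonneg ?_
    rw [le_div_iff₀ hc]
    linarith
  have hlogn : 0 ≤ Real.log n := Real.log_nonneg (Nat.one_le_cast.2 hn)
  have hexpn : Real.exp (Real.log n) = n := Real.exp_log hn'
  have hexpΛ : Real.exp (-Λ) = c / (16 * h) := by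
    rw [Real.exp_neg, hΛ, Real.exp_log (by positivity), inv_div]
  have hxi : ballExp h Λ x (i + 1) ≤ (1 - η) * Real.log n := (ballExp_mono hh hΛ0 i.2).trans hx
  have hballs : 0 ≤ ballExp h Λ x i := (exponents_nonneg hΛ0 i).2
  -- The block length is at least `16`, so that rounding it down loses at most a factor `2`.
  have hbig : 16 ≤ c * n * Real.exp (-ballExp h Λ x i) / h := by
    have h1 : ballExp h Λ x i + Λ ≤ Real.log n := by
      have h2 := ballExp_add_le_succ (x := x) hh hΛ0 i
      nlinarith
    have h3 : Real.exp (ballExp h Λ x i + Λ) ≤ n := hexpn ▸ Real.exp_le_exp.2 h1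
    have h4 : 1 ≤ n * Real.exp (-(ballExp h Λ x i + Λ)) := by
      rw [Real.exp_neg, ← div_eq_mul_inv, le_div_iff₀ (Real.exp_pos _), one_mul]
      exact h3
    rw [neg_add, Real.exp_add, hexpΛ] at h4
    have h5 : c * n * Real.exp (-ballExp h Λ x i) / h =
        16 * (n * (Real.exp (-ballExp h Λ x i) * (c / (16 * h)))) := by
      field_simp
    rw [h5]
    linarith
  set b := blockLength n h Λ c x i with hb
  have hb1 : c * n * Real.exp (-ballExp h Λ x i) / (2 * h) ≤ b := by
    have h1 := Nat.lt_floor_add_one (c * n * Real.exp (-ballExp h Λ x i) / h)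
    have h2 : c * n * Real.exp (-ballExp h Λ x i) / (2 * h) =
        c * n * Real.exp (-ballExp h Λ x i) / h / 2 := by
      field_simp
    rw [h2, hb, blockLength]
    linarith
  have hbn : b ≤ n := by
    refine Nat.floor_le_of_le ?_
    rw [div_le_iff₀ hh']
    have h1 : Real.exp (-ballExp h Λ x i) ≤ 1 := Real.exp_le_one_iff.2 (by linarith)
    have h2 : c * n * Real.exp (-ballExp h Λ x i) ≤ 1 * n * 1 := by gcongr
    nlinarith
  have hprob : 4 * Real.exp (-(ballExp h Λ x i + Λ)) ≤ hitProb n b := by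
    refine le_trans ?_ (le_hitProb hn hbn)
    rw [neg_add, Real.exp_add, hexpΛ, le_div_iff₀ (by positivity)]
    refine le_of_eq_of_le ?_ hb1
    field_simp
    norm_num
  have hprobh : 4 * Real.exp (-(h * (ballExp h Λ x i + Λ))) ≤ hitProb n b ^ h := by
    refine le_trans ?_ (pow_le_pow_left₀ (by positivity) hprob h)
    rw [mul_pow, ← Real.exp_nat_mul, mul_neg]
    refine mul_le_mul_of_nonneg_right ?_ (Real.exp_pos _).le
    calc (4 : ℝ) = 4 ^ 1 := (pow_one 4).symm
      _ ≤ 4 ^ h := pow_le_pow_right₀ (by norm_num) hh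
  have hN : 4 * (n * Real.exp (-ballExp h Λ x (i + 1))) ≤
      n * Real.exp (-binExp h Λ x (i + 1)) * hitProb n b ^ h := by
    rw [ballExp_succ', neg_add, Real.exp_add]
    have h1 : 0 ≤ n * Real.exp (-binExp h Λ x (i + 1)) := by positivity
    have := mul_le_mul_of_nonneg_left hprobh h1
    linarith
  have hY : 0 < n * Real.exp (-ballExp h Λ x (i + 1)) := by positivity
  refine le_trans (measure_mono ?_) ((hg.measure_few_hits_le hZ hn ht
    (h * ∑ j ∈ Finset.range (i + 1), x j) i h b hY hN).trans (ENNReal.ofReal_le_ofReal ?_))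
  · intro ω hω
    simp only [Set.mem_ofPred_eq, ManyHits, Classical.not_imp, not_le] at hω
    exact hω
  · rw [← hexpn, ← Real.exp_add, one_div, ← Real.exp_neg, hexpn]
    refine Real.exp_le_exp.2 ?_
    linarith

theorem IsStrategy.measure_maxLoad_lt_le (hg : IsStrategy P Z g) (hZ : IsPool P Z) (hn : 0 < n)
    {h : ℕ} (hh : 0 < h) {c Λ : ℝ} (hc : 0 < c) (hc1 : c ≤ 1) (hΛ : Λ = Real.log (16 * h / c))
    {J : ℕ} (hJ : 0 < J) {η : ℝ} (hη : 0 ≤ η)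
    (hx : ∀ x ∈ states d J, ballExp h Λ x d ≤ (1 - η) * Real.log n) {τ T : ℕ} (hτ : c * n ≤ τ)
    (hT : ((J + 1) ^ d + 1) * τ ≤ T) :
    P {ω | MaxLoad Z g T ω < h * J} ≤
      ((((J + 1) ^ d) * ((finite_states d J).toFinset.card * d) : ℕ) : ENNReal) *
        ENNReal.ofReal (Real.exp (-(η * Real.log n))) := by
  have hn' : (0 : ℝ) < n := Nat.cast_pos.2 hn
  have hτ0 : 0 < τ := by
    have : (0 : ℝ) < τ := lt_of_lt_of_le (by positivity) hτ
    exact Nat.cast_pos.1 this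
  -- The stages start one stage length late, because a history is needed at their beginning.
  let t : ℕ → ℕ := fun q => (q + 1) * τ
  have ht : Monotone t := fun q q' hq => Nat.mul_le_mul_right τ (by omega)
  let B : ℕ → (ℕ → ℕ) → Fin d → Set Ω := fun q x i =>
    {ω | ¬ ManyHits (fun k l => g k l ω) (fun l r => Z l r ω) h Λ c x (t q) i}
  have hsub : {ω | MaxLoad Z g T ω < h * J} ⊆ ⋃ q ∈ Finset.range ((J + 1) ^ d),
      ⋃ x ∈ (finite_states d J).toFinset, ⋃ i ∈ (Finset.univ : Finset (Fin d)), B q x i := by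
    intro ω hω
    by_contra hcon
    simp only [B, Set.mem_iUnion, Finset.mem_range, Set.Finite.mem_toFinset, Finset.mem_univ,
      Set.mem_ofPred_eq, not_exists, not_not] at hcon
    obtain ⟨m, hm⟩ := exists_le_load (a := fun k l => g k l ω) (z := fun l r => Z l r ω) hn hc hc1
      hJ ht (fun q => by
        have : t (q + 1) - t q = τ := by
          have : t (q + 1) = t q + τ := by simp only [t]; ring
          omega
        rw [this]; exact hτ) (fun q hq x hx i => hcon q hq x hx i trivial)
    refine absurd hω (not_lt.2 (hm.trans ?_))
    exact (load_mono _ _ m hT).trans (load_le_maxLoad _ _ m T)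
  refine (measure_mono hsub).trans ?_
  set δ := ENNReal.ofReal (Real.exp (-(η * Real.log n))) with hδ
  have h1 : ∀ q, ∀ x ∈ (finite_states d J).toFinset, P (⋃ i ∈ (Finset.univ : Finset (Fin d)),
      B q x i) ≤ d * δ := by
    intro q x hxs
    refine (measure_biUnion_finset_le _ _).trans ((Finset.sum_le_sum fun i _ =>
      hg.measure_not_manyHits_le hZ hn hh hc hc1 hΛ hη
        (hx x ((finite_states d J).mem_toFinset.1 hxs))
        (Nat.mul_pos (Nat.succ_pos q) hτ0) i).trans ?_)
    rw [Finset.sum_const, Finset.card_univ, Fintype.card_fin, nsmul_eq_mul]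
  have h2 : ∀ q, P (⋃ x ∈ (finite_states d J).toFinset, ⋃ i ∈ (Finset.univ : Finset (Fin d)),
      B q x i) ≤ (finite_states d J).toFinset.card * (d * δ) := by
    intro q
    refine (measure_biUnion_finset_le _ _).trans ((Finset.sum_le_sum (h1 q)).trans ?_)
    rw [Finset.sum_const, nsmul_eq_mul]
  refine (measure_biUnion_finset_le _ _).trans ((Finset.sum_le_sum fun q _ => h2 q).trans ?_)
  rw [Finset.sum_const, Finset.card_range, nsmul_eq_mul]
  push_cast
  simp only [mul_assoc, le_refl]

end LowerBound

/-! ### The asymptotics of the threshold -/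

section Asymptotics

theorem tendsto_log_pnat : Tendsto (fun n : ℕ+ => Real.log (n : ℝ)) atTop atTop :=
  Real.tendsto_log_atTop.comp (tendsto_natCast_atTop_atTop.comp tendsto_PNat_val_atTop_atTop)

variable (d : ℕ) [NeZero d]

theorem tendsto_level : Tendsto (level d) atTop atTop := by
  have hd : (0 : ℝ) < d := Nat.cast_pos.2 (NeZero.pos d)
  have h1 : Tendsto (fun y : ℝ => y / Real.log y) atTop atTop := by
    have h2 : Tendsto (fun y : ℝ => Real.log y / y) atTop (𝓝[>] 0) := by
      refine tendsto_nhdsWithin_iff.2 ⟨Real.isLittleO_log_id_atTop.tendsto_div_nhds_zero, ?_⟩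
      filter_upwards [eventually_gt_atTop 1] with y hy
      exact div_pos (Real.log_pos hy) (by linarith)
    have h3 := h2.inv_tendsto_nhdsGT_zero
    refine h3.congr fun y => ?_
    simp
  have h4 : Tendsto (fun n : ℕ+ => d * (Real.log n / Real.log (Real.log n))) atTop atTop :=
    (h1.comp tendsto_log_pnat).const_mul_atTop hd
  refine ((tendsto_rpow_atTop (y := (1 / d : ℝ)) (by positivity)).comp h4).congr fun n => ?_
  rw [Function.comp, level, mul_div_assoc]

/-- The defining property of the threshold: `ℓ ^ d log ℓ` is asymptotic to `log n`, and this is not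
affected by adding a constant to `log ℓ`. -/
theorem tendsto_level_pow_mul_log (C : ℝ) :
    Tendsto (fun n : ℕ+ => level d n ^ d * (Real.log (level d n) + C) / Real.log n) atTop
      (𝓝 1) := by
  have hd : (0 : ℝ) < d := Nat.cast_pos.2 (NeZero.pos d)
  have hlog := tendsto_log_pnat
  have hloglog : Tendsto (fun n : ℕ+ => Real.log (Real.log n)) atTop atTop :=
    Real.tendsto_log_atTop.comp hlog
  have h1 : Tendsto (fun u : ℝ => 1 + ((Real.log d + d * C) / u - Real.log u / u)) atTop
      (𝓝 (1 + (0 - 0))) :=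
    tendsto_const_nhds.add ((tendsto_const_nhds.div_atTop tendsto_id).sub
      Real.isLittleO_log_id_atTop.tendsto_div_nhds_zero)
  rw [sub_zero, add_zero] at h1
  refine (h1.comp hloglog).congr' ?_
  filter_upwards [hlog.eventually_gt_atTop 0, hloglog.eventually_gt_atTop 0] with n hn hn2
  have hpos : 0 < d * Real.log n / Real.log (Real.log n) := by positivity
  have hpow : level d n ^ d = d * Real.log n / Real.log (Real.log n) := by
    rw [level, one_div, Real.rpow_inv_natCast_pow hpos.le (NeZero.ne d)]
  have hl : Real.log (level d n) =
      1 / d * (Real.log d + Real.log (Real.log n) - Real.log (Real.log (Real.log n))) := by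
    rw [level, Real.log_rpow hpos, Real.log_div (by positivity) hn2.ne',
      Real.log_mul hd.ne' hn.ne']
  rw [hpow, hl, Function.comp]
  field_simp
  ring

end Asymptotics

/-! ### Bounds with high probability -/

section HighProbability

variable (d : ℕ) [NeZero d]

/-- By the inequality of arithmetic and geometric means, a product of `d` numbers is largest when
they are equal. -/
theorem prod_range_le_pow {y : ℕ → ℝ} (hy : ∀ j, 0 ≤ y j) {s : ℝ}
    (hs : ∑ j ∈ Finset.range d, y j ≤ d * s) : ∏ j ∈ Finset.range d, y j ≤ s ^ d := by
  have hd : (0 : ℝ) < d := Nat.cast_pos.2 (NeZero.pos d)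
  have h1 := Real.geom_mean_le_arith_mean (Finset.range d) (fun _ => 1) y (fun _ _ => zero_le_one)
    (by simpa using NeZero.pos d) (fun j _ => hy j)
  simp only [Real.rpow_one, Finset.sum_const, Finset.card_range, nsmul_eq_mul, mul_one,
    one_mul] at h1
  have h0 : 0 ≤ ∏ j ∈ Finset.range d, y j := Finset.prod_nonneg fun j _ => hy j
  have h2 : (∑ j ∈ Finset.range d, y j) / d ≤ s := by
    rw [div_le_iff₀ hd]; linarith
  have h3 := pow_le_pow_left₀ (Real.rpow_nonneg h0 _) (h1.trans h2) d
  rwa [Real.rpow_inv_natCast_pow h0 (NeZero.ne d)] at h3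

variable {d} {ρ : ℝ} {Ω : ℕ+ → Type*} [∀ n, MeasurableSpace (Ω n)] {P : ∀ n, Measure (Ω n)}
  {Z : ∀ n : ℕ+, Fin d → ℕ → Ω n → Fin n}

theorem tendsto_ofReal_exp_neg_atTop {f : ℕ+ → ℝ} (hf : Tendsto f atTop atTop) :
    Tendsto (fun n => ENNReal.ofReal (Real.exp (-f n))) atTop (𝓝 0) := by
  have := ENNReal.tendsto_ofReal (Real.tendsto_exp_neg_atTop_nhds_zero.comp hf)
  rwa [ENNReal.ofReal_zero] at this

theorem tendsto_measure_lt_maxLoad_threshold (hρ : 0 < ρ) (hZ : ∀ n, IsPool (P n) (Z n))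
    {ε : ℝ} (hε : 0 < ε) :
    Tendsto (fun n => P n {ω | (d + ε) * level d n <
      (MaxLoad (Z n) (thresholdStrategy (level d n) (Z n)) ⌊ρ * (n : ℝ)⌋₊ ω : ℝ)}) atTop
      (𝓝 0) := by
  have hd := NeZero.pos d
  have hd1 : (1 : ℝ) ≤ d := Nat.one_le_cast.2 hd
  set e := ε / 2 with he
  have he0 : 0 < e := by positivity
  set C := -(2 + Real.log ρ) with hC
  have hl := tendsto_level d
  have hlog := tendsto_log_pnat
  have hlogl : Tendsto (fun n => Real.log (level d n)) atTop atTop := Real.tendsto_log_atTop.comp hl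
  let K : ℕ+ → ℕ := fun n => ⌊level d n⌋₊ + 2
  let S : ℕ+ → ℕ := fun n => ⌈(1 + e) * level d n⌉₊
  have hratio : ∀ᶠ n : ℕ+ in atTop, (1 + e / 2) / (1 + e) <
      level d n ^ d * (Real.log (level d n) + C) / Real.log n := by
    refine (tendsto_level_pow_mul_log d C).eventually_const_lt ?_
    rw [div_lt_one (by linarith)]
    linarith
  have hbound : ∀ᶠ n : ℕ+ in atTop, P n {ω | (d + ε) * level d n <
      (MaxLoad (Z n) (thresholdStrategy (level d n) (Z n)) ⌊ρ * (n : ℝ)⌋₊ ω : ℝ)} ≤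
      d * ENNReal.ofReal (Real.exp (-level d n)) +
        ENNReal.ofReal (Real.exp (-(e / 2 * Real.log n))) := by
    filter_upwards [hratio, hl.eventually_ge_atTop 1, hl.eventually_ge_atTop (2 / e),
      hl.eventually_ge_atTop (d / e), hlogl.eventually_ge_atTop 2,
      hlogl.eventually_ge_atTop (-C), hlog.eventually_gt_atTop 0] with n h1 h2 h3 h4 h5 h6 h7
    rw [div_le_iff₀ he0] at h3 h4
    have hl0 : 0 < level d n := by linarith
    have hK1 : level d n ≤ K n := by
      have := Nat.lt_floor_add_one (level d n)
      simp only [K]; push_cast; linarith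
    have hK2 : (K n : ℝ) ≤ (1 + e) * level d n := by
      have := Nat.floor_le hl0.le
      simp only [K]; push_cast; linarith
    have hS1 : (1 + e) * level d n ≤ S n := Nat.le_ceil _
    have hS2 : (S n : ℝ) < (1 + e) * level d n + 1 := Nat.ceil_lt_add_one (by positivity)
    have hS0 : (0 : ℝ) < S n := lt_of_lt_of_le (by positivity) hS1
    have hK0 : 0 < K n := by simp only [K]; omega
    have hK0' : (0 : ℝ) < K n := Nat.cast_pos.2 hK0
    refine (measure_mono ?_).trans (((hZ n).measure_lt_maxLoad_threshold_le n.pos hl0.le hρ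
      (K := K n) rfl (T := ⌊ρ * (n : ℝ)⌋₊) rfl (S := S n) (Nat.cast_pos.1 hS0)).trans
      (add_le_add ?_ (ENNReal.ofReal_le_ofReal ?_)))
    · intro ω hω
      rw [Set.mem_ofPred_eq] at hω ⊢
      rw [← Nat.cast_lt (α := ℝ)]
      refine lt_of_le_of_lt ?_ hω
      push_cast [Nat.cast_sub (Nat.one_le_iff_ne_zero.2 (Nat.cast_pos.1 hS0).ne'),
        Nat.cast_sub (Nat.one_le_iff_ne_zero.2 hd.ne')]
      have := Nat.floor_le hl0.le
      have h8 : ((d : ℝ) - 1) * (⌊level d n⌋₊ + 1) ≤ (d - 1) * (level d n + 1) := by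
        gcongr
      nlinarith
    · gcongr
    · -- The logarithm of the left-hand side is computed from the growth of the exponents.
      have hw := reachFrac_pos hK0 hρ (d - 1)
      have hlogK : 2 ≤ Real.log (K n) := h5.trans (Real.log_le_log hl0 hK1)
      have hG := pow_mul_le_neg_log_reachFrac hK0 hρ hlogK (d - 1)
      have hKS : Real.log (K n) ≤ Real.log (S n) := Real.log_le_log hK0' (hK2.trans hS1)
      have hn0 : (0 : ℝ) < (n : ℕ) := Nat.cast_pos.2 n.pos
      rw [← Real.log_le_iff_le_exp (by positivity), Real.log_mul hn0.ne' (by positivity),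
        Real.log_pow, Real.log_div (by positivity) hS0.ne',
        Real.log_mul (Real.exp_ne_zero 1) hw.ne', Real.log_exp]
      have hlogl0 : 0 ≤ Real.log (level d n) + C := by linarith
      have h8 : level d n ^ (d - 1) * (Real.log (level d n) + C) ≤
          Real.log (S n) - 1 - Real.log (reachFrac (K n) ρ (d - 1)) := by
        have h9 : level d n ^ (d - 1) * (Real.log (level d n) + C) ≤
            (K n : ℝ) ^ (d - 1) * (Real.log (K n) - 2 - Real.log ρ) := by
          have := Real.log_le_log hl0 hK1
          gcongr
          rw [hC]; linarith
        linarith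
      have h10 : (1 + e) * (level d n ^ d * (Real.log (level d n) + C)) ≤
          S n * (Real.log (S n) - 1 - Real.log (reachFrac (K n) ρ (d - 1))) := by
        have h11 : level d n ^ d = level d n * level d n ^ (d - 1) := by
          rw [← pow_succ']; congr 1; omega
        have h12 : 0 ≤ level d n ^ (d - 1) * (Real.log (level d n) + C) := by positivity
        calc (1 + e) * (level d n ^ d * (Real.log (level d n) + C))
            = ((1 + e) * level d n) * (level d n ^ (d - 1) * (Real.log (level d n) + C)) := by
              rw [h11]; ring
          _ ≤ _ := mul_le_mul hS1 h8 h12 hS0.le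
      rw [div_lt_iff₀ (by linarith), div_mul_eq_mul_div, lt_div_iff₀ h7] at h1
      nlinarith
  have hlim : Tendsto (fun n : ℕ+ => (d : ENNReal) * ENNReal.ofReal (Real.exp (-level d n)) +
      ENNReal.ofReal (Real.exp (-(e / 2 * Real.log n)))) atTop (𝓝 (d * 0 + 0)) :=
    (ENNReal.Tendsto.const_mul (tendsto_ofReal_exp_neg_atTop hl)
      (Or.inr (ENNReal.natCast_ne_top d))).add
      (tendsto_ofReal_exp_neg_atTop (hlog.const_mul_atTop (by positivity)))
  rw [mul_zero, add_zero] at hlim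
  exact tendsto_of_tendsto_of_tendsto_of_le_of_le' tendsto_const_nhds hlim
    (Eventually.of_forall fun _ => zero_le) hbound

theorem tendsto_measure_maxLoad_lt [∀ n, IsProbabilityMeasure (P n)] (hρ : 0 < ρ)
    (hZ : ∀ n, IsPool (P n) (Z n))
    {g : ∀ n : ℕ+, ℕ → Fin (d - 1) → Ω n → Bool} (hg : ∀ n, IsStrategy (P n) (Z n) (g n))
    {ε : ℝ} (hε : 0 < ε) (hεd : ε < d) :
    Tendsto (fun n => P n {ω | (MaxLoad (Z n) (g n) ⌊ρ * (n : ℝ)⌋₊ ω : ℝ) <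
      (d - ε) * level d n}) atTop (𝓝 0) := by
  have hd := NeZero.pos d
  have hd1 : (1 : ℝ) ≤ d := Nat.one_le_cast.2 hd
  have hl := tendsto_level d
  have hlog := tendsto_log_pnat
  set D := d - ε with hD
  have hD0 : 0 < D := by linarith
  -- The number `J` of increments makes the loss by discretization small.
  obtain ⟨J, hJ⟩ : ∃ J : ℕ, 4 * d * D / ε < J := exists_nat_gt _
  have hJ0' : (0 : ℝ) < J := lt_of_le_of_lt (by positivity) hJ
  have hJ0 : 0 < J := Nat.cast_pos.1 hJ0'
  set M := (J + 1) ^ d with hM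
  set c := min 1 (ρ / (2 * (M + 1))) with hc
  have hc0 : 0 < c := lt_min one_pos (by positivity)
  have hc1 : c ≤ 1 := min_le_left _ _
  set C := Real.log (16 * (D + 1) / c) with hC
  set κ := (1 - ε / (2 * d)) ^ d with hκ
  have hκb : 0 < 1 - ε / (2 * d) := by
    rw [sub_pos, div_lt_one (by positivity)]; linarith
  have hκ0 : 0 < κ := pow_pos hκb d
  have hκ1 : κ < 1 := by
    refine pow_lt_one₀ hκb.le ?_ (NeZero.ne d)
    have : 0 < ε / (2 * d) := by positivity
    linarith
  set η := (1 - κ) / 2 with hη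
  have hη0 : 0 < η := by rw [hη]; linarith
  let h : ℕ+ → ℕ := fun n => ⌈D * level d n / J⌉₊
  have hratio : ∀ᶠ n : ℕ+ in atTop,
      level d n ^ d * (Real.log (level d n) + C) / Real.log n < (1 - η) / κ := by
    refine (tendsto_level_pow_mul_log d C).eventually_lt_const ?_
    rw [lt_div_iff₀ hκ0, hη]
    linarith
  have hcast : Tendsto (fun n : ℕ+ => (n : ℝ)) atTop atTop :=
    tendsto_natCast_atTop_atTop.comp tendsto_PNat_val_atTop_atTop
  have hbound : ∀ᶠ n : ℕ+ in atTop, P n {ω | (MaxLoad (Z n) (g n) ⌊ρ * (n : ℝ)⌋₊ ω : ℝ) <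
      D * level d n} ≤
      ((M * ((finite_states d J).toFinset.card * d) : ℕ) : ENNReal) *
        ENNReal.ofReal (Real.exp (-(η * Real.log n))) := by
    filter_upwards [hratio, hl.eventually_ge_atTop 1,
      hl.eventually_ge_atTop ((J + 2 * d) / (ε / 4)),
      hlog.eventually_gt_atTop 0, hcast.eventually_ge_atTop ((M + 2) * 2 / ρ)]
      with n h1 h2 h3 h4 h5
    have hl0 : 0 < level d n := by linarith
    have hh1 : D * level d n / J ≤ h n := Nat.le_ceil _
    have hh2 : (h n : ℝ) < D * level d n / J + 1 := Nat.ceil_lt_add_one (by positivity)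
    have hh0' : (0 : ℝ) < h n := lt_of_lt_of_le (by positivity) hh1
    have hh0 : 0 < h n := Nat.cast_pos.1 hh0'
    set Λ := Real.log (16 * h n / c) with hΛ
    have hΛ0 : 0 ≤ Λ := by
      refine Real.log_nonneg ?_
      rw [le_div_iff₀ hc0]
      have : (1 : ℝ) ≤ h n := Nat.one_le_cast.2 hh0
      linarith
    have hhl : (h n : ℝ) ≤ (D + 1) * level d n := by
      have : D * level d n / J ≤ D * level d n :=
        div_le_self (by positivity) (Nat.one_le_cast.2 hJ0)
      linarith
    have hΛle : Λ ≤ Real.log (level d n) + C := by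
      rw [hΛ, hC, ← Real.log_mul hl0.ne' (by positivity)]
      refine Real.log_le_log (by positivity) ?_
      rw [mul_div_assoc', div_le_div_iff_of_pos_right hc0]
      nlinarith
    have hx : ∀ x ∈ states d J, ballExp (h n) Λ x d ≤ (1 - η) * Real.log (n : ℕ) := by
      intro x hx
      have e1 := ballExp_add_le_prod (h := h n) (x := x) hΛ0 d
      have e2 : ∑ j ∈ Finset.range d, ((x j + 1) * h n + 1 : ℝ) ≤
          d * ((1 - ε / (2 * d)) * level d n) := by
        have e3 : ∑ j ∈ Finset.range d, ((x j + 1) * h n + 1 : ℝ) =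
            ((∑ j ∈ Finset.range d, x j : ℕ) + d) * h n + d := by
          rw [Finset.sum_add_distrib, ← Finset.sum_mul, Finset.sum_add_distrib]
          simp
        have e4 : ((∑ j ∈ Finset.range d, x j : ℕ) : ℝ) ≤ J := Nat.cast_le.2 hx.2.le
        have e5 : ((J : ℝ) + d) * h n ≤ (J + d) * (D * level d n / J + 1) := by gcongr
        have e6 : ((J : ℝ) + d) * (D * level d n / J + 1) =
            D * level d n + (d * D / J) * level d n + (J + d) := by
          field_simp
        have e7 : d * D / J ≤ ε / 4 := by
          rw [div_lt_iff₀ hε] at hJ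
          rw [div_le_iff₀ hJ0']
          linarith
        have e8 : (d * D / J) * level d n ≤ ε / 4 * level d n :=
          mul_le_mul_of_nonneg_right e7 hl0.le
        rw [div_le_iff₀ (by positivity)] at h3
        have e9 : d * ((1 - ε / (2 * d)) * level d n) = (d - ε / 2) * level d n := by
          field_simp
        rw [e3, e9]
        have e10 : ((∑ j ∈ Finset.range d, x j : ℕ) + d : ℝ) * h n ≤ (J + d) * h n := by
          gcongr
        have e11 : (d - ε / 2) * level d n =
          D * level d n + ε / 4 * level d n + level d n * (ε / 4) := by rw [hD]; ring
        linarith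
      have e12 := prod_range_le_pow d (y := fun j => ((x j + 1) * h n + 1 : ℝ))
        (fun j => by positivity) e2
      rw [mul_pow] at e12
      have e13 : (∏ j ∈ Finset.range d, ((x j + 1) * h n + 1 : ℝ)) * Λ ≤
          κ * level d n ^ d * (Real.log (level d n) + C) := by
        refine mul_le_mul e12 hΛle hΛ0 (by positivity)
      rw [div_lt_iff₀ h4, div_mul_eq_mul_div, lt_div_iff₀ hκ0] at h1
      have e14 : κ * level d n ^ d * (Real.log (level d n) + C) =
        level d n ^ d * (Real.log (level d n) + C) * κ := by ring
      linarith
    have hn0 : (0 : ℝ) < (n : ℕ) := Nat.cast_pos.2 n.pos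
    set T := ⌊ρ * (n : ℝ)⌋₊ with hT
    have hT1 : ρ * n - 1 ≤ T := (Nat.sub_one_lt_floor _).le
    have hM0 : (0 : ℝ) < (M : ℝ) + 1 := by positivity
    have hτ : c * (n : ℕ) ≤ ((T / (M + 1) : ℕ) : ℝ) := by
      have f1 : (T : ℝ) / (M + 1) - 1 ≤ ((T / (M + 1) : ℕ) : ℝ) := by
        have := Nat.sub_one_lt_floor ((T : ℝ) / ((M + 1 : ℕ) : ℝ))
        rw [Nat.floor_div_eq_div] at this
        push_cast at this
        exact this.le
      refine le_trans ?_ f1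
      have f2 : c * n ≤ ρ / (2 * (M + 1)) * n := by
        gcongr
        exact min_le_right _ _
      refine f2.trans ?_
      rw [div_le_iff₀ hρ] at h5
      rw [le_sub_iff_add_le, le_div_iff₀ hM0]
      have f3 : (ρ / (2 * (M + 1)) * n + 1) * (M + 1) = ρ * n / 2 + (M + 1) := by
        field_simp
      rw [f3]
      linarith
    refine (measure_mono ?_).trans ((hg n).measure_maxLoad_lt_le (hZ n) n.pos hh0 hc0 hc1 hΛ hJ0
      hη0.le hx hτ (T := T) (Nat.mul_div_le T (M + 1)))
    intro ω hω
    rw [Set.mem_ofPred_eq] at hω ⊢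
    rw [← Nat.cast_lt (α := ℝ)]
    refine lt_of_lt_of_le hω ?_
    push_cast
    rwa [div_le_iff₀ hJ0'] at hh1
  have hlim : Tendsto (fun n : ℕ+ =>
      ((M * ((finite_states d J).toFinset.card * d) : ℕ) : ENNReal) *
        ENNReal.ofReal (Real.exp (-(η * Real.log n)))) atTop
      (𝓝 (((M * ((finite_states d J).toFinset.card * d) : ℕ) : ENNReal) * 0)) :=
    ENNReal.Tendsto.const_mul
      (tendsto_ofReal_exp_neg_atTop (hlog.const_mul_atTop hη0))
      (Or.inr (ENNReal.natCast_ne_top _))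
  rw [mul_zero] at hlim
  exact tendsto_of_tendsto_of_tendsto_of_le_of_le' tendsto_const_nhds hlim
    (Eventually.of_forall fun _ => zero_le) hbound

end HighProbability

/-! ### From every fixed error to a vanishing error -/

section Diagonal

variable {Ω : ℕ+ → Type*} [∀ n, MeasurableSpace (Ω n)] {P : ∀ n, Measure (Ω n)}

/-- If events that increase with the error `ε` have high probability for each fixed `ε > 0`, they
still have for a suitable `ε n → 0`. With `e n` the infimum of the errors `ε` for which the event
fails with probability at most `ε`, one may take `ε n = e n + 1 / n`. -/
theorem exists_tendsto_zero [∀ n, IsProbabilityMeasure (P n)] {E : ∀ n : ℕ+, ℝ → Set (Ω n)}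
    (hmono : ∀ᶠ n in atTop, Monotone (E n))
    (hE : ∀ ε > 0, Tendsto (fun n => P n (E n ε)ᶜ) atTop (𝓝 0)) :
    ∃ ε : ℕ+ → ℝ, Tendsto ε atTop (𝓝 0) ∧ Tendsto (fun n => P n (E n (ε n))) atTop (𝓝 1) := by
  let A : ℕ+ → Set ℝ := fun n => {ε | 0 ≤ ε ∧ P n (E n ε)ᶜ ≤ ENNReal.ofReal ε}
  have hA1 : ∀ n, (1 : ℝ) ∈ A n := fun n => ⟨zero_le_one, by
    rw [ENNReal.ofReal_one]; exact prob_le_one⟩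
  have hAb : ∀ n, BddBelow (A n) := fun n => ⟨0, fun ε h => h.1⟩
  have hinv : Tendsto (fun n : ℕ+ => 1 / (n : ℝ)) atTop (𝓝 0) :=
    tendsto_const_nhds.div_atTop
      (tendsto_natCast_atTop_atTop.comp tendsto_PNat_val_atTop_atTop)
  have he : Tendsto (fun n => sInf (A n)) atTop (𝓝 0) := by
    refine tendsto_order.2 ⟨fun b hb => Eventually.of_forall fun n =>
      hb.trans_le (Real.sInf_nonneg fun ε h => h.1), fun b hb => ?_⟩
    have hb2 : 0 < b / 2 := by linarith
    have h1 : ∀ᶠ n in atTop, P n (E n (b / 2))ᶜ < ENNReal.ofReal (b / 2) :=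
      (hE _ hb2).eventually_lt_const (ENNReal.ofReal_pos.2 hb2)
    filter_upwards [h1] with n hn
    have := csInf_le (hAb n) (⟨hb2.le, hn.le⟩ : b / 2 ∈ A n)
    linarith
  have hε : Tendsto (fun n : ℕ+ => sInf (A n) + 1 / (n : ℝ)) atTop (𝓝 0) := by
    simpa using he.add hinv
  refine ⟨_, hε, ?_⟩
  have hcompl : ∀ᶠ n : ℕ+ in atTop, P n (E n (sInf (A n) + 1 / (n : ℝ)))ᶜ ≤
      ENNReal.ofReal (sInf (A n) + 1 / (n : ℝ)) := by
    filter_upwards [hmono] with n hn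
    have hpos : 0 < 1 / (n : ℝ) := by
      have : (0 : ℝ) < (n : ℕ) := Nat.cast_pos.2 n.pos
      positivity
    obtain ⟨ε, h1, h2⟩ := exists_lt_of_csInf_lt ⟨1, hA1 n⟩
      (lt_add_of_pos_right (sInf (A n)) hpos)
    exact (measure_mono (Set.compl_subset_compl.2 (hn h2.le))).trans
      (h1.2.trans (ENNReal.ofReal_le_ofReal h2.le))
  have hlim : Tendsto (fun n : ℕ+ => 1 - ENNReal.ofReal (sInf (A n) + 1 / (n : ℝ))) atTop
      (𝓝 (1 - 0)) := by
    have h1 := ENNReal.tendsto_ofReal hε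
    rw [ENNReal.ofReal_zero] at h1
    exact ENNReal.Tendsto.sub tendsto_const_nhds h1 (Or.inl ENNReal.one_ne_top)
  rw [tsub_zero] at hlim
  refine tendsto_of_tendsto_of_tendsto_of_le_of_le' hlim tendsto_const_nhds ?_
    (Eventually.of_forall fun n => prob_le_one)
  filter_upwards [hcompl] with n hn
  refine tsub_le_iff_right.2 ?_
  calc (1 : ENNReal) = P n Set.univ := measure_univ.symm
    _ ≤ P n (E n (sInf (A n) + 1 / (n : ℝ))) + P n (E n (sInf (A n) + 1 / (n : ℝ)))ᶜ := by
        rw [← Set.union_compl_self (E n (sInf (A n) + 1 / (n : ℝ)))]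
        exact measure_union_le _ _
    _ ≤ _ := by gcongr

theorem tendsto_measure_zero_of_subset_union {A B C : ∀ n, Set (Ω n)}
    (hsub : ∀ᶠ n in atTop, A n ⊆ B n ∪ C n)
    (hB : Tendsto (fun n => P n (B n)) atTop (𝓝 0))
    (hC : Tendsto (fun n => P n (C n)) atTop (𝓝 0)) :
    Tendsto (fun n => P n (A n)) atTop (𝓝 0) := by
  have h := hB.add hC
  rw [add_zero] at h
  refine tendsto_of_tendsto_of_tendsto_of_le_of_le' tendsto_const_nhds h
    (Eventually.of_forall fun _ => zero_le) ?_
  filter_upwards [hsub] with n hn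
  exact (measure_mono hn).trans (measure_union_le _ _)

end Diagonal

end Thinning

theorem theorem1 (d : ℕ) [NeZero d] (ρ : ℝ) (hρ : 0 < ρ)
    {Ω : ℕ+ → Type*} [∀ n, MeasurableSpace (Ω n)]
    (P : ∀ n, Measure (Ω n)) [∀ n, IsProbabilityMeasure (P n)]
    (Z : ∀ n : ℕ+, Fin d → ℕ → Ω n → Fin n) (hZ : ∀ n, Thinning.IsPool (P n) (Z n)) :
    Thinning.AsymptoticallyOptimal P Z (fun n => ⌊ρ * (n : ℝ)⌋₊)
      (fun n => Thinning.thresholdStrategy (Thinning.level d n) (Z n)) ∧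
    ∃ ε : ℕ+ → ℝ, Tendsto ε atTop (𝓝 0) ∧
      Tendsto (fun n => P n {ω |
        |(Thinning.MaxLoad (Z n) (Thinning.thresholdStrategy (Thinning.level d n) (Z n))
            ⌊ρ * (n : ℝ)⌋₊ ω : ℝ) - d * Thinning.level d n| ≤ ε n * Thinning.level d n})
        atTop (𝓝 1) := by
  have hd1 : (1 : ℝ) ≤ d := Nat.one_le_cast.2 (NeZero.pos d)
  have hstrat : ∀ n, Thinning.IsStrategy (P n) (Z n)
      (Thinning.thresholdStrategy (Thinning.level d n) (Z n)) := fun n =>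
    (hZ n).isStrategy_threshold _
  have hlevel := (Thinning.tendsto_level d).eventually_ge_atTop 0
  refine ⟨⟨hstrat, fun g hg => ?_⟩, ?_⟩
  · refine Thinning.exists_tendsto_zero (E := fun n ε => {ω |
      (Thinning.MaxLoad (Z n) (Thinning.thresholdStrategy (Thinning.level d n) (Z n))
            ⌊ρ * (n : ℝ)⌋₊ ω : ℝ) ≤
        (1 + ε) * Thinning.MaxLoad (Z n) (g n) ⌊ρ * (n : ℝ)⌋₊ ω})
      (Eventually.of_forall fun n ε ε' h ω hω => ?_)
      fun ε hε => ?_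
    · rw [Set.mem_ofPred_eq] at hω ⊢
      refine hω.trans ?_
      gcongr
    · -- The error `δ` is so small that `d + δ ≤ (1 + ε) (d - δ)`.
      set δ := min (1 / 2) (ε / (2 + ε)) with hδ
      have hδ0 : 0 < δ := lt_min (by norm_num) (by positivity)
      have hδ1 : δ ≤ 1 / 2 := min_le_left _ _
      have hδ2 : δ * (2 + ε) ≤ ε := by
        rw [← le_div_iff₀ (by positivity)]; exact min_le_right _ _
      refine Thinning.tendsto_measure_zero_of_subset_union ?_
        (Thinning.tendsto_measure_lt_maxLoad_threshold hρ hZ hδ0)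
        (Thinning.tendsto_measure_maxLoad_lt hρ hZ hg hδ0 (by linarith))
      filter_upwards [hlevel] with n hn ω hω
      by_contra hcon
      simp only [Set.mem_union, Set.mem_ofPred_eq, not_or, not_lt] at hcon
      refine hω ?_
      rw [Set.mem_ofPred_eq]
      refine hcon.1.trans (le_trans ?_ (mul_le_mul_of_nonneg_left hcon.2 (by linarith)))
      rw [← mul_assoc]
      refine mul_le_mul_of_nonneg_right ?_ hn
      nlinarith
  · refine Thinning.exists_tendsto_zero (E := fun n ε => {ω |
      |(Thinning.MaxLoad (Z n) (Thinning.thresholdStrategy (Thinning.level d n) (Z n))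
            ⌊ρ * (n : ℝ)⌋₊ ω : ℝ) - d * Thinning.level d n| ≤ ε * Thinning.level d n})
      ?_ fun ε hε => ?_
    · filter_upwards [hlevel] with n hn ε ε' h ω hω
      rw [Set.mem_ofPred_eq] at hω ⊢
      exact hω.trans (mul_le_mul_of_nonneg_right h hn)
    · set δ := min (1 / 2) ε with hδ
      have hδ0 : 0 < δ := lt_min (by norm_num) hε
      have hδ1 : δ ≤ 1 / 2 := min_le_left _ _
      have hδ2 : δ ≤ ε := min_le_right _ _
      refine Thinning.tendsto_measure_zero_of_subset_union ?_
        (Thinning.tendsto_measure_lt_maxLoad_threshold hρ hZ hε)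
        (Thinning.tendsto_measure_maxLoad_lt hρ hZ hstrat hδ0 (by linarith))
      filter_upwards [hlevel] with n hn ω hω
      by_contra hcon
      simp only [Set.mem_union, Set.mem_ofPred_eq, not_or, not_lt] at hcon
      refine hω ?_
      rw [Set.mem_ofPred_eq, abs_le]
      have := mul_le_mul_of_nonneg_right hδ2 hn
      constructor <;> nlinarith [hcon.1, hcon.2]
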